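/- **Setting.** Let $W=\bigoplus_{q\in\mathbb Z}W^q$ be a commutative differential graded algebra over $\mathbb Q$ (not necessarily unital; for an augmented algebra one takes its augmentation ideal), with differential of degree $+1$, and let $H^*(W)$ be its cohomology. *The bicomplex.* Let $\mathbb E(W)=\bigoplus_{n\ge1}(\mathrm{Graphs}(n)/\!\sim)\otimes_{\Sigma_n}W^{\otimes n}$. Here $\mathrm{Graphs}(n)$ is the $\mathbb Q$-vector space spanned by the directed trees (connected acyclic directed graphs) on $n$ labelled vertices. The relation $\sim$ is generated by arrow reversing (reversing one arrow changes the sign) and by the Arnold identity (for distinct vertices $a,b,c$, the three graphs that contain, besides the same other edges, $\{a\to b,\,b\to c\}$, $\{b\to c,\,c\to a\}$ and $\{c\to a,\,a\to b\}$ respectively, add up to $0$). The symmetric group $\Sigma_n$ acts diagonally, with Koszul signs for the desuspended degrees $|w|-1$. Let $d_W$ be the extension of the differential of $W$ to $\mathbb E(W)$, with Koszul signs for the desuspended degrees, and let $d_\mu=\sum_e\mu_e$, where $\mu_e$ contracts the edge $e$: if a representative is chosen in which $e$ goes from vertex $1$ to vertex $2$ and the tensor is $a\otimes b\otimes\cdots$,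 then the new tensor is $(-1)^{|a|}(ab)\otimes\cdots$. Place a graph with $n$ vertices and labels $w_1,\dots,w_n$ in bidegree $(p,q)=(1-n,\sum_i|w_i|)$, and let $D=d_W+d_\mu$. *The spectral sequence.* The Sinha–Walter spectral sequence $(E_s^{p,q},d_s)$ of $W$ is the spectral sequence of $(\mathbb E(W),D)$ filtered by columns, $F^p$ being spanned by the graphs with at most $1-p$ vertices, with $d_s:E_s^{p,q}\to E_s^{p+s,q-s+1}$. For $s\ge1$ the graphs with one vertex give a natural map $H^q(W)\to E_s^{0,q}$; write $[m]$ for the image of $m$. Write $a_1|a_2|\cdots|a_r$ for the class in $\mathbb E(W)$ of the graph $1\to2\to\cdots\to r$ with the tensor $a_1\otimes\cdots\otimes a_r$. If the $a_i$ are homogeneous cocycles, let $[a_1|\cdots|a_r]$ be its class in $E_1^{1-r,q}$, where $q=\sum_i|a_i|$. A class in $E_1^{p,q}$ survives to page $s\ge1$ if it is represented by some $z\in F^p$ of total degree $p+q$ with $Dz\in F^{p+s}$; the class of $z$ in $E_s^{p,q}$ is then the class that it gives on page $s$. *Massey products.* Let $r\ge2$ and let $a_1,\dots,a_r\in W$ be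 homogeneous cocycles. A defining system for $\langle[a_1],\dots,[a_r]\rangle$ consists of homogeneous elements $M_{ij}\in W$, for $1\le i\le j\le r$ with $(i,j)\ne(1,r)$, of degree $|a_i|+\dots+|a_j|-(j-i)$, such that $M_{ii}$ is a cocycle that represents $[a_i]$ and, for $i<j$, $$dM_{ij}=\sum_{k=i}^{j-1}\overline{M_{ik}}\,M_{k+1,j},\qquad \overline{x}=(-1)^{|x|+1}x .$$ The $r$-th order Massey product $\langle[a_1],\dots,[a_r]\rangle\subseteq H^{q-r+2}(W)$ is the set of the classes of $\sum_{k=1}^{r-1}\overline{M_{1k}}\,M_{k+1,r}$ over all defining systems. It is defined if there is a defining system. **Proposition.** Let $r\ge2$ and let $a_1,\dots,a_r\in W$ be homogeneous cocycles, $q=\sum_i|a_i|$. Suppose that the $r$-th order Massey product $\langle[a_1],\dots,[a_r]\rangle$ is defined and that $[a_1|a_2|\cdots|a_r]\ne0$ in $E_1^{1-r,q}$. Then $[a_1|a_2|\cdots|a_r]$ survives to the page $E_{r-1}$, and $$d_{r-1}(a_1|a_2|\cdots|a_r)\in\pm\big[\langle[a_1],[a_2],\dots,[a_r]\rangle\big]\subseteq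 E_{r-1}^{0,\,q-r+2}.$$ That is, for every class $y\in E_{r-1}^{1-r,q}$ that $[a_1|\cdots|a_r]$ gives on page $r-1$, there is $m\in\langle[a_1],\dots,[a_r]\rangle$ with $d_{r-1}(y)=[m]$ or $d_{r-1}(y)=-[m]$. -/

import Mathlib

noncomputable section

open Finset Finsupp

set_option linter.unusedSimpArgs false
set_option linter.unusedTactic false

/-- The sign `(-1) ^ m`, as a rational number. -/
def sgn (m : ℤ) : ℚ := (-1) ^ m

/-- A commutative differential graded algebra over `ℚ`, graded by `ℤ`, on the underlying
(not necessarily unital) `ℚ`-algebra `W`. -/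
structure CDGA (W : Type*) [NonUnitalRing W] [Module ℚ W] [IsScalarTower ℚ W W]
    [SMulCommClass ℚ W W] where
  /-- the homogeneous components -/
  gr : ℤ → Submodule ℚ W
  isInternal : DirectSum.IsInternal gr
  mul_mem : ∀ {m n : ℤ} {x y : W}, x ∈ gr m → y ∈ gr n → x * y ∈ gr (m + n)
  mul_comm : ∀ {m n : ℤ} {x y : W}, x ∈ gr m → y ∈ gr n → x * y = sgn (m * n) • (y * x)
  /-- the differential -/
  d : W →ₗ[ℚ] W
  d_mem : ∀ {m : ℤ} {x : W}, x ∈ gr m → d x ∈ gr (m + 1)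
  d_d : ∀ x : W, d (d x) = 0
  leibniz : ∀ {m n : ℤ} {x y : W}, x ∈ gr m → y ∈ gr n →
    d (x * y) = d x * y + sgn m • (x * d y)

/-! ### Signs -/

theorem sgn_add (m n : ℤ) : sgn (m + n) = sgn m * sgn n :=
  zpow_add₀ (by norm_num) m n

theorem sgn_one : sgn 1 = -1 := by simp [sgn]

theorem sgn_zero : sgn 0 = 1 := by simp [sgn]

theorem sgn_congr {m n : ℤ} (h : (m : ZMod 2) = n) : sgn m = sgn n := by
  have h2 : ((2 : ℕ) : ℤ) ∣ n - m := (ZMod.intCast_eq_intCast_iff_dvd_sub m n 2).1 h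
  obtain ⟨c, hc⟩ := h2
  have : n = m + 2 * c := by push_cast at hc; omega
  rw [this, sgn_add]
  have : sgn (2 * c) = 1 := by rw [sgn, zpow_mul]; norm_num
  rw [this, mul_one]

theorem sgn_mul_self (m : ℤ) : sgn m * sgn m = 1 := by
  rw [← sgn_add, ← sgn_zero]
  apply sgn_congr
  push_cast
  exact CharTwo.add_self_eq_zero _

theorem neg_sgn (m : ℤ) : -sgn m = sgn (m + 1) := by
  rw [sgn_add, sgn_one]; ring

/-! ### Graphs and trees -/

/-- A finite directed graph whose vertices are natural numbers, together with a degree and a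
label in `W` attached to each vertex.  Only the values of `deg` and `lab` on `verts` matter. The
labels, in the increasing order of the vertices, are the factors of an elementary tensor. -/
structure LGraph (W : Type*) where
  /-- the vertices -/
  verts : Finset ℕ
  /-- the edges; `(i, j)` is an edge from `i` to `j` -/
  edges : Multiset (ℕ × ℕ)
  /-- the degrees of the labels -/
  deg : ℕ → ℤ
  /-- the labels -/
  lab : ℕ → W

/-- The vertices `S` and the directed edges `E` form a tree after forgetting the directions: a
connected graph with one more vertex than edges (so it has no loops, no multiple edges and no
cycles). -/
structure IsTree (S : Finset ℕ) (E : Multiset (ℕ × ℕ)) : Prop where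
  mem : ∀ e ∈ E, e.1 ∈ S ∧ e.2 ∈ S
  conn : ∀ x ∈ S, ∀ y ∈ S, Relation.EqvGen (fun a b => (a, b) ∈ E) x y
  card : S.card = E.card + 1

/-- The map of vertices that sends `j` to `i` and fixes all the others. -/
def collapse (i j x : ℕ) : ℕ := if x = j then i else x

theorem eqvGen_map {E : Multiset (ℕ × ℕ)} {F : Multiset (ℕ × ℕ)} (f : ℕ → ℕ)
    (h : ∀ a b, (a, b) ∈ E → Relation.EqvGen (fun a b => (a, b) ∈ F) (f a) (f b)) {x y : ℕ}
    (hxy : Relation.EqvGen (fun a b => (a, b) ∈ E) x y) :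
    Relation.EqvGen (fun a b => (a, b) ∈ F) (f x) (f y) := by
  induction hxy with
  | rel a b hab => exact h a b hab
  | refl a => exact .refl _
  | symm a b _ ih => exact .symm _ _ ih
  | trans a b c _ _ ih1 ih2 => exact .trans _ _ _ ih1 ih2

theorem card_le_of_conn (E : Multiset (ℕ × ℕ)) : ∀ S : Finset ℕ,
    (∀ x ∈ S, ∀ y ∈ S, Relation.EqvGen (fun a b => (a, b) ∈ E) x y) → S.card ≤ E.card + 1 := by
  induction hn : E.card generalizing E with
  | zero =>
    intro S h
    obtain rfl := Multiset.card_eq_zero.1 hn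
    refine Finset.card_le_one.2 fun x hx y hy => ?_
    have := eqvGen_map (F := 0) id (by simp) (h x hx y hy)
    have key : ∀ {x y : ℕ}, Relation.EqvGen (fun a b => (a, b) ∈ (0 : Multiset (ℕ × ℕ))) x y →
        x = y := by
      intro x y hxy
      induction hxy with
      | rel a b hab => simp at hab
      | refl a => rfl
      | symm a b _ ih => exact ih.symm
      | trans a b c _ _ ih1 ih2 => exact ih1.trans ih2
    exact key (h x hx y hy)
  | succ n ih =>
    intro S h
    obtain ⟨⟨a, b⟩, hab⟩ := Multiset.card_pos_iff_exists_mem.1 (by omega : 0 < E.card)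
    obtain ⟨E', rfl⟩ := Multiset.exists_cons_of_mem hab
    have hE' : E'.card = n := by simpa using hn
    have h1 := ih (E'.map (Prod.map (collapse a b) (collapse a b))) (by simpa using hE')
      (S.image (collapse a b)) (by
        intro x hx y hy
        obtain ⟨x', hx', rfl⟩ := Finset.mem_image.1 hx
        obtain ⟨y', hy', rfl⟩ := Finset.mem_image.1 hy
        refine eqvGen_map _ ?_ (h x' hx' y' hy')
        intro c d hcd
        rcases Multiset.mem_cons.1 hcd with hcd | hcd
        · obtain ⟨rfl, rfl⟩ := Prod.mk.inj hcd
          have : collapse c d c = collapse c d d := by simp [collapse]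
          rw [this]; exact .refl _
        · exact .rel _ _ (Multiset.mem_map.2 ⟨(c, d), hcd, rfl⟩))
    have h2 : S.erase b ⊆ S.image (collapse a b) := by
      intro x hx
      obtain ⟨hxb, hx⟩ := Finset.mem_erase.1 hx
      exact Finset.mem_image.2 ⟨x, hx, by simp [collapse, hxb]⟩
    have h3 := Finset.card_le_card h2
    have h4 := Finset.pred_card_le_card_erase (s := S) (a := b)
    omega

theorem IsTree.ne {S : Finset ℕ} {E : Multiset (ℕ × ℕ)} (h : IsTree S E) {e : ℕ × ℕ}
    (he : e ∈ E) : e.1 ≠ e.2 := by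
  intro heq
  have h1 := card_le_of_conn (E.erase e) S (by
    intro x hx y hy
    refine eqvGen_map id ?_ (h.conn x hx y hy)
    intro a b hab
    rw [← Multiset.cons_erase he] at hab
    rcases Multiset.mem_cons.1 hab with hab | hab
    · rw [← hab] at heq; simp only at heq; subst heq; exact .refl _
    · exact .rel _ _ hab)
  have h2 := h.card
  have h3 := Multiset.card_erase_add_one he
  omega

theorem IsTree.map {S : Finset ℕ} {E : Multiset (ℕ × ℕ)} (h : IsTree S E) {f : ℕ → ℕ}
    (hf : Set.InjOn f S) : IsTree (S.image f) (E.map (Prod.map f f)) where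
  mem e he := by
    obtain ⟨e', he', rfl⟩ := Multiset.mem_map.1 he
    exact ⟨mem_image_of_mem f (h.mem e' he').1, mem_image_of_mem f (h.mem e' he').2⟩
  conn x hx y hy := by
    obtain ⟨x', hx', rfl⟩ := Finset.mem_image.1 hx
    obtain ⟨y', hy', rfl⟩ := Finset.mem_image.1 hy
    exact eqvGen_map f (fun a b hab => .rel _ _ (Multiset.mem_map.2 ⟨(a, b), hab, rfl⟩))
      (h.conn x' hx' y' hy')
  card := by rw [Finset.card_image_of_injOn hf, Multiset.card_map, h.card]

theorem IsTree.contract {S : Finset ℕ} {E : Multiset (ℕ × ℕ)} (h : IsTree S E) {e : ℕ × ℕ}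
    (he : e ∈ E) : IsTree (S.erase e.2)
      ((E.erase e).map (Prod.map (collapse e.1 e.2) (collapse e.1 e.2))) where
  mem f hf := by
    have key : ∀ x ∈ S, collapse e.1 e.2 x ∈ S.erase e.2 := by
      intro x hx
      by_cases hxe : x = e.2
      · simpa [collapse, hxe] using ⟨h.ne he, (h.mem e he).1⟩
      · simpa [collapse, hxe] using hx
    obtain ⟨f', hf', rfl⟩ := Multiset.mem_map.1 hf
    have := h.mem f' (Multiset.mem_of_mem_erase hf')
    exact ⟨key _ this.1, key _ this.2⟩
  conn x hx y hy := by
    obtain ⟨hxe, hx⟩ := Finset.mem_erase.1 hx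
    obtain ⟨hye, hy⟩ := Finset.mem_erase.1 hy
    have := eqvGen_map (F := (E.erase e).map (Prod.map (collapse e.1 e.2) (collapse e.1 e.2)))
      (collapse e.1 e.2) ?_ (h.conn x hx y hy)
    · simpa [collapse, hxe, hye] using this
    · intro a b hab
      rw [← Multiset.cons_erase he] at hab
      rcases Multiset.mem_cons.1 hab with hab | hab
      · rw [← hab]
        have : collapse a b a = collapse a b b := by simp [collapse]
        simp only
        rw [this]; exact .refl _
      · exact .rel _ _ (Multiset.mem_map.2 ⟨(a, b), hab, rfl⟩)
  card := by
    rw [Finset.card_erase_of_mem (h.mem e he).2, Multiset.card_map, h.card,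
      Multiset.card_erase_of_mem he]
    have := Multiset.card_pos_iff_exists_mem.2 ⟨e, he⟩
    simp only [Nat.pred_eq_sub_one]
    omega

theorem IsTree.congr {S : Finset ℕ} {E F : Multiset (ℕ × ℕ)} (h : IsTree S E)
    (hmem : ∀ e ∈ F, e.1 ∈ S ∧ e.2 ∈ S)
    (hconn : ∀ a b, (a, b) ∈ E → Relation.EqvGen (fun a b => (a, b) ∈ F) a b)
    (hcard : F.card = E.card) : IsTree S F :=
  ⟨hmem, fun x hx y hy => eqvGen_map id hconn (h.conn x hx y hy), by rw [hcard, h.card]⟩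

theorem IsTree.reverse {S : Finset ℕ} {E : Multiset (ℕ × ℕ)} {a b : ℕ}
    (h : IsTree S ((a, b) ::ₘ E)) : IsTree S ((b, a) ::ₘ E) := by
  refine h.congr ?_ ?_ (by simp)
  · intro e he
    rcases Multiset.mem_cons.1 he with rfl | he
    · exact (h.mem (a, b) (by simp)).symm
    · exact h.mem e (by simp [he])
  · intro c d hcd
    rcases Multiset.mem_cons.1 hcd with hcd | hcd
    · obtain ⟨rfl, rfl⟩ := Prod.mk.inj hcd
      exact .symm _ _ (.rel _ _ (by simp))
    · exact .rel _ _ (by simp [hcd])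

theorem IsTree.rotate {S : Finset ℕ} {E : Multiset (ℕ × ℕ)} {a b c : ℕ}
    (h : IsTree S ((a, b) ::ₘ (b, c) ::ₘ E)) : IsTree S ((b, c) ::ₘ (c, a) ::ₘ E) := by
  refine h.congr ?_ ?_ (by simp)
  · have h1 := h.mem (a, b) (by simp)
    have h2 := h.mem (b, c) (by simp)
    intro e he
    rcases Multiset.mem_cons.1 he with rfl | he
    · exact h2
    rcases Multiset.mem_cons.1 he with rfl | he
    · exact ⟨h2.2, h1.1⟩
    · exact h.mem e (by simp [he])
  · intro x y hxy
    rcases Multiset.mem_cons.1 hxy with hxy | hxy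
    · obtain ⟨rfl, rfl⟩ := Prod.mk.inj hxy
      exact .symm _ _ (.trans _ c _ (.rel _ _ (by simp)) (.rel _ _ (by simp)))
    rcases Multiset.mem_cons.1 hxy with hxy | hxy
    · exact .rel _ _ (by simp [hxy])
    · exact .rel _ _ (by simp [hxy])

/-! ### Sign exponents -/

/-- The sum of the desuspended degrees `deg k - 1` over the vertices `k < x`. -/
def before (S : Finset ℕ) (p : ℕ → ℤ) (x : ℕ) : ℤ :=
  ∑ k ∈ S, if k < x then p k - 1 else 0

/-- The exponent of the Koszul sign of the permutation of tensor factors that a relabelling `σ` of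
the vertices induces: the sum, over the pairs of vertices whose order `σ` reverses, of the products
of the desuspended degrees. -/
def koszul (S : Finset ℕ) (p : ℕ → ℤ) (σ : ℕ → ℕ) : ℤ :=
  ∑ k ∈ S, ∑ l ∈ S, if k < l ∧ σ l < σ k then (p k - 1) * (p l - 1) else 0

def cross (S : Finset ℕ) (p : ℕ → ℤ) (σ : ℕ → ℕ) (x : ℕ) : ℤ :=
  ∑ k ∈ S, if (k < x ∧ σ x < σ k) ∨ (x < k ∧ σ k < σ x) then p k - 1 else 0

theorem before_erase {S : Finset ℕ} {j : ℕ} (hj : j ∈ S) (p : ℕ → ℤ) (x : ℕ) :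
    before (S.erase j) p x = before S p x - if j < x then p j - 1 else 0 := by
  rw [before, before, ← Finset.add_sum_erase S _ hj]; ring

theorem before_congr {S : Finset ℕ} {p q : ℕ → ℤ} (h : ∀ k ∈ S, p k = q k) (x : ℕ) :
    before S p x = before S q x :=
  Finset.sum_congr rfl fun k hk => by rw [h k hk]

theorem before_update {S : Finset ℕ} {i : ℕ} (hi : i ∈ S) (p : ℕ → ℤ) (v : ℤ) (x : ℕ) :
    before S (Function.update p i v) x = before S p x + if i < x then v - p i else 0 := by
  have h1 := before_erase hi p x
  have h2 := before_erase hi (Function.update p i v) x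
  have h3 : before (S.erase i) (Function.update p i v) x = before (S.erase i) p x :=
    before_congr (fun k hk => by simp [Finset.ne_of_mem_erase hk]) x
  rw [h3, h1] at h2
  simp only [Function.update_self] at h2
  split_ifs at * <;> linarith

theorem cross_erase {S : Finset ℕ} {j : ℕ} (hj : j ∈ S) (p : ℕ → ℤ) (σ : ℕ → ℕ) (x : ℕ) :
    cross (S.erase j) p σ x = cross S p σ x -
      if (j < x ∧ σ x < σ j) ∨ (x < j ∧ σ j < σ x) then p j - 1 else 0 := by
  rw [cross, cross, ← Finset.add_sum_erase S _ hj]; ring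

theorem cross_congr {S : Finset ℕ} {p q : ℕ → ℤ} (h : ∀ k ∈ S, p k = q k) (σ : ℕ → ℕ) (x : ℕ) :
    cross S p σ x = cross S q σ x :=
  Finset.sum_congr rfl fun k hk => by rw [h k hk]

theorem koszul_congr {S : Finset ℕ} {p q : ℕ → ℤ} (h : ∀ k ∈ S, p k = q k) (σ : ℕ → ℕ) :
    koszul S p σ = koszul S q σ :=
  Finset.sum_congr rfl fun k hk => Finset.sum_congr rfl fun l hl => by rw [h k hk, h l hl]

theorem koszul_erase {S : Finset ℕ} {j : ℕ} (hj : j ∈ S) (p : ℕ → ℤ) (σ : ℕ → ℕ) :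
    koszul (S.erase j) p σ = koszul S p σ - (p j - 1) * cross (S.erase j) p σ j := by
  have : koszul S p σ = koszul (S.erase j) p σ + (p j - 1) * cross (S.erase j) p σ j := by
    simp only [koszul, cross]
    rw [← Finset.add_sum_erase S _ hj]
    simp_rw [← Finset.add_sum_erase S _ hj]
    rw [Finset.sum_add_distrib, Finset.mul_sum]
    simp only [lt_self_iff_false, false_and, if_false, zero_add]
    rw [← add_assoc, ← Finset.sum_add_distrib, add_comm]
    congr 1
    refine Finset.sum_congr rfl fun k hk => ?_
    rcases lt_trichotomy j k with h | h | h
    · by_cases h' : σ k < σ j <;> simp [h, h', h.not_gt]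
    · simp [h]
    · by_cases h' : σ j < σ k <;> simp [h, h', h.not_gt, mul_comm]
  rw [this]; ring

theorem koszul_update {S : Finset ℕ} {i : ℕ} (hi : i ∈ S) (p : ℕ → ℤ) (v : ℤ) (σ : ℕ → ℕ) :
    koszul S (Function.update p i v) σ = koszul S p σ + (v - p i) * cross (S.erase i) p σ i := by
  have h1 := koszul_erase hi p σ
  have h2 := koszul_erase hi (Function.update p i v) σ
  have h3 : koszul (S.erase i) (Function.update p i v) σ = koszul (S.erase i) p σ :=
    koszul_congr (fun k hk => by simp [Finset.ne_of_mem_erase hk]) σ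
  have h4 : cross (S.erase i) (Function.update p i v) σ i = cross (S.erase i) p σ i :=
    cross_congr (fun k hk => by simp [Finset.ne_of_mem_erase hk]) σ i
  rw [h3, h1, h4] at h2
  simp only [Function.update_self] at h2
  linarith

theorem koszul_eq_zero {S : Finset ℕ} (p : ℕ → ℤ) {σ : ℕ → ℕ} (h : ∀ k ∈ S, σ k = k) :
    koszul S p σ = 0 :=
  Finset.sum_eq_zero fun k hk => Finset.sum_eq_zero fun l hl => by
    rw [h k hk, h l hl, if_neg]; omega

theorem before_image {S : Finset ℕ} {p p' : ℕ → ℤ} {σ : ℕ → ℕ} (hσ : Set.InjOn σ S)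
    (hp : ∀ k ∈ S, p' (σ k) = p k) {x : ℕ} (hx : x ∈ S) :
    (before (S.image σ) p' (σ x) : ZMod 2) = before S p x + cross S p σ x := by
  rw [before, Finset.sum_image hσ, before, cross, ← Int.cast_add, ← Finset.sum_add_distrib]
  push_cast
  refine Finset.sum_congr rfl fun k hk => ?_
  rw [hp k hk]
  rcases eq_or_ne k x with rfl | hkx
  · simp
  have hne : σ k ≠ σ x := fun h => hkx (hσ hk hx h)
  have h2 : ∀ t : ZMod 2, t + t = 0 := by decide
  rcases lt_or_gt_of_ne hkx with h | h <;> rcases lt_or_gt_of_ne hne with h' | h' <;>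
    simp [h, h', h.not_gt, h'.not_gt, h2]

/-! ### The cofree graded Lie coalgebra -/

variable {W : Type*} [NonUnitalRing W] [Module ℚ W] [IsScalarTower ℚ W W] [SMulCommClass ℚ W W]

/-- A legitimate generator: a tree, each of whose labels is homogeneous of the stated degree. -/
def CDGA.Valid (A : CDGA W) (g : LGraph W) : Prop :=
  IsTree g.verts g.edges ∧ ∀ k ∈ g.verts, g.lab k ∈ A.gr (g.deg k)

/-- The relations between labelled graphs. -/
inductive CDGA.Rel (A : CDGA W) : (LGraph W →₀ ℚ) → Prop
  /-- only the legitimate generators count -/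
  | invalid (g : LGraph W) (hg : ¬ A.Valid g) : A.Rel (single g 1)
  /-- multilinearity in the labels: additivity -/
  | add (S : Finset ℕ) (E : Multiset (ℕ × ℕ)) (p : ℕ → ℤ) (w : ℕ → W) (k : ℕ) (x y : W)
      (hk : k ∈ S) (hx : A.Valid ⟨S, E, p, Function.update w k x⟩)
      (hy : A.Valid ⟨S, E, p, Function.update w k y⟩) :
      A.Rel (single ⟨S, E, p, Function.update w k (x + y)⟩ 1 -
        single ⟨S, E, p, Function.update w k x⟩ 1 - single ⟨S, E, p, Function.update w k y⟩ 1)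
  /-- multilinearity in the labels: homogeneity -/
  | smul (S : Finset ℕ) (E : Multiset (ℕ × ℕ)) (p : ℕ → ℤ) (w : ℕ → W) (k : ℕ) (c : ℚ) (x : W)
      (hk : k ∈ S) (hx : A.Valid ⟨S, E, p, Function.update w k x⟩) :
      A.Rel (single ⟨S, E, p, Function.update w k (c • x)⟩ 1 -
        c • single ⟨S, E, p, Function.update w k x⟩ 1)
  /-- diagonal action of the permutations, and more generally of the bijections between vertex
  sets, on graphs and tensors -/
  | relabel (S : Finset ℕ) (E : Multiset (ℕ × ℕ)) (p p' : ℕ → ℤ) (w w' : ℕ → W) (σ : ℕ → ℕ)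
      (hσ : Set.InjOn σ S) (hp : ∀ k ∈ S, p' (σ k) = p k) (hw : ∀ k ∈ S, w' (σ k) = w k)
      (h : A.Valid ⟨S, E, p, w⟩) :
      A.Rel (single ⟨S, E, p, w⟩ 1 -
        sgn (koszul S p σ) • single ⟨S.image σ, E.map (Prod.map σ σ), p', w'⟩ 1)
  /-- reversing an arrow -/
  | reverse (S : Finset ℕ) (E : Multiset (ℕ × ℕ)) (p : ℕ → ℤ) (w : ℕ → W) (a b : ℕ)
      (h : A.Valid ⟨S, (a, b) ::ₘ E, p, w⟩) :
      A.Rel (single ⟨S, (a, b) ::ₘ E, p, w⟩ 1 + single ⟨S, (b, a) ::ₘ E, p, w⟩ 1)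
  /-- the Arnold identity -/
  | arnold (S : Finset ℕ) (E : Multiset (ℕ × ℕ)) (p : ℕ → ℤ) (w : ℕ → W) (a b c : ℕ)
      (h : A.Valid ⟨S, (a, b) ::ₘ (b, c) ::ₘ E, p, w⟩) :
      A.Rel (single ⟨S, (a, b) ::ₘ (b, c) ::ₘ E, p, w⟩ 1 +
        single ⟨S, (b, c) ::ₘ (c, a) ::ₘ E, p, w⟩ 1 + single ⟨S, (c, a) ::ₘ (a, b) ::ₘ E, p, w⟩ 1)

/-- The subspace spanned by the relations. -/
def CDGA.relations (A : CDGA W) : Submodule ℚ (LGraph W →₀ ℚ) :=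
  Submodule.span ℚ {x | A.Rel x}

/-- The vector space `𝔼(W)` underlying the cofree Lie coalgebra on (the desuspension of) `W`:
labelled trees modulo multilinearity, relabelling, arrow reversal and the Arnold identity. Every
tree with `n` vertices can be relabelled by any `n` numbers, so this is the direct sum over `n ≥ 1`
of the coinvariants under the symmetric group `Σ_n` of `(Graphs(n) / ~) ⊗ W^{⊗ n}`. -/
abbrev CDGA.LieCoalg (A : CDGA W) : Type _ := (LGraph W →₀ ℚ) ⧸ A.relations

/-- The class of a labelled graph in `𝔼(W)`. -/
def CDGA.gen (A : CDGA W) (g : LGraph W) : A.LieCoalg := A.relations.mkQ (single g 1)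

theorem CDGA.rel_zero (A : CDGA W) {x : LGraph W →₀ ℚ} (h : A.Rel x) : A.relations.mkQ x = 0 := by
  rw [Submodule.mkQ_apply, Submodule.Quotient.mk_eq_zero]
  exact Submodule.subset_span h

theorem CDGA.gen_invalid (A : CDGA W) {g : LGraph W} (hg : ¬ A.Valid g) : A.gen g = 0 :=
  A.rel_zero (.invalid g hg)

theorem CDGA.gen_add (A : CDGA W) {S : Finset ℕ} {E : Multiset (ℕ × ℕ)} {p : ℕ → ℤ} {w : ℕ → W}
    {k : ℕ} {x y : W} (hk : k ∈ S) (hx : x ∈ A.gr (p k)) (hy : y ∈ A.gr (p k)) :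
    A.gen ⟨S, E, p, Function.update w k (x + y)⟩ =
      A.gen ⟨S, E, p, Function.update w k x⟩ + A.gen ⟨S, E, p, Function.update w k y⟩ := by
  have key : ∀ z z' : W, z' ∈ A.gr (p k) → A.Valid ⟨S, E, p, Function.update w k z⟩ →
      A.Valid ⟨S, E, p, Function.update w k z'⟩ := by
    intro z z' hz' h
    refine ⟨h.1, fun l hl => ?_⟩
    rcases eq_or_ne l k with rfl | hne
    · simpa using hz'
    · have := h.2 l hl
      simpa [hne] using this
  by_cases h : A.Valid ⟨S, E, p, Function.update w k x⟩
  · have := A.rel_zero (.add S E p w k x y hk h (key _ _ hy h))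
    rw [map_sub, map_sub] at this
    rw [sub_sub, sub_eq_zero] at this
    exact this
  · rw [A.gen_invalid h, A.gen_invalid fun h' => h (key _ _ hx h'),
      A.gen_invalid fun h' => h (key _ _ hx h'), add_zero]

theorem CDGA.gen_smul (A : CDGA W) {S : Finset ℕ} {E : Multiset (ℕ × ℕ)} {p : ℕ → ℤ} {w : ℕ → W}
    {k : ℕ} {x : W} (c : ℚ) (hk : k ∈ S) (hx : x ∈ A.gr (p k)) :
    A.gen ⟨S, E, p, Function.update w k (c • x)⟩ =
      c • A.gen ⟨S, E, p, Function.update w k x⟩ := by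
  by_cases h : A.Valid ⟨S, E, p, Function.update w k x⟩
  · have := A.rel_zero (.smul S E p w k c x hk h)
    rw [map_sub, map_smul, sub_eq_zero] at this
    exact this
  · rw [A.gen_invalid h, A.gen_invalid, smul_zero]
    intro h'
    refine h ⟨h'.1, fun l hl => ?_⟩
    rcases eq_or_ne l k with rfl | hne
    · simpa using hx
    · have := h'.2 l hl
      simpa [hne] using this

theorem CDGA.gen_relabel (A : CDGA W) {S : Finset ℕ} {E : Multiset (ℕ × ℕ)} {p p' : ℕ → ℤ}
    {w w' : ℕ → W} {σ : ℕ → ℕ}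
    (hσ : Set.InjOn σ S) (hp : ∀ k ∈ S, p' (σ k) = p k) (hw : ∀ k ∈ S, w' (σ k) = w k)
    (h : A.Valid ⟨S, E, p, w⟩) :
    A.gen ⟨S, E, p, w⟩ =
      sgn (koszul S p σ) • A.gen ⟨S.image σ, E.map (Prod.map σ σ), p', w'⟩ := by
  have := A.rel_zero (.relabel S E p p' w w' σ hσ hp hw h)
  rw [map_sub, map_smul, sub_eq_zero] at this
  exact this

theorem CDGA.Valid.congr {A : CDGA W} {S : Finset ℕ} {E : Multiset (ℕ × ℕ)} {p p' : ℕ → ℤ}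
    {w w' : ℕ → W} (hp : ∀ k ∈ S, p' k = p k) (hw : ∀ k ∈ S, w' k = w k)
    (h : A.Valid ⟨S, E, p, w⟩) : A.Valid ⟨S, E, p', w'⟩ :=
  ⟨h.1, fun k hk => by
    have := h.2 k hk
    simp only at this ⊢
    rwa [hp k hk, hw k hk]⟩

theorem CDGA.gen_congr (A : CDGA W) {S : Finset ℕ} {E : Multiset (ℕ × ℕ)} {p p' : ℕ → ℤ}
    {w w' : ℕ → W} (hp : ∀ k ∈ S, p' k = p k) (hw : ∀ k ∈ S, w' k = w k) :
    A.gen ⟨S, E, p, w⟩ = A.gen ⟨S, E, p', w'⟩ := by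
  by_cases h : A.Valid ⟨S, E, p, w⟩
  · rw [A.gen_relabel (σ := id) (p' := p') (w' := w') Function.injective_id.injOn hp hw h,
      koszul_eq_zero p (σ := id) (fun _ _ => rfl), sgn_zero, one_smul]
    simp
  · rw [A.gen_invalid h, A.gen_invalid fun h' => h ?_]
    exact h'.congr (fun k hk => (hp k hk).symm) (fun k hk => (hw k hk).symm)

theorem CDGA.gen_reverse (A : CDGA W) (S : Finset ℕ) (E : Multiset (ℕ × ℕ)) (p : ℕ → ℤ)
    (w : ℕ → W) (a b : ℕ) :
    A.gen ⟨S, (a, b) ::ₘ E, p, w⟩ = -A.gen ⟨S, (b, a) ::ₘ E, p, w⟩ := by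
  by_cases h : A.Valid ⟨S, (a, b) ::ₘ E, p, w⟩
  · have := A.rel_zero (.reverse S E p w a b h)
    rw [map_add] at this
    exact eq_neg_of_add_eq_zero_left this
  · have h2 : ¬ A.Valid ⟨S, (b, a) ::ₘ E, p, w⟩ := fun h' => h ⟨IsTree.reverse h'.1, h'.2⟩
    rw [A.gen_invalid h, A.gen_invalid h2, neg_zero]

theorem CDGA.gen_arnold (A : CDGA W) (S : Finset ℕ) (E : Multiset (ℕ × ℕ)) (p : ℕ → ℤ)
    (w : ℕ → W) (a b c : ℕ) :
    A.gen ⟨S, (a, b) ::ₘ (b, c) ::ₘ E, p, w⟩ + A.gen ⟨S, (b, c) ::ₘ (c, a) ::ₘ E, p, w⟩ +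
      A.gen ⟨S, (c, a) ::ₘ (a, b) ::ₘ E, p, w⟩ = 0 := by
  by_cases h : A.Valid ⟨S, (a, b) ::ₘ (b, c) ::ₘ E, p, w⟩
  · have := A.rel_zero (.arnold S E p w a b c h)
    rw [map_add, map_add] at this
    exact this
  · have h2 : ¬ A.Valid ⟨S, (b, c) ::ₘ (c, a) ::ₘ E, p, w⟩ := fun h' =>
      h ⟨IsTree.rotate (IsTree.rotate h'.1), h'.2⟩
    have h3 : ¬ A.Valid ⟨S, (c, a) ::ₘ (a, b) ::ₘ E, p, w⟩ := fun h' =>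
      h ⟨IsTree.rotate h'.1, h'.2⟩
    rw [A.gen_invalid h, A.gen_invalid h2, A.gen_invalid h3, add_zero, add_zero]

/-- To define a linear map on `𝔼(W)` it suffices to give its values on the legitimate generators,
compatibly with the relations. -/
theorem CDGA.lift_aux (A : CDGA W) {M : Type*} [AddCommGroup M] [Module ℚ M] (f : LGraph W → M)
    (h : ∀ x, A.Rel x → Finsupp.linearCombination ℚ f x = 0) :
    A.relations ≤ LinearMap.ker (Finsupp.linearCombination ℚ f) :=
  Submodule.span_le.2 fun x hx => h x hx

/-! ### The two differentials -/

/-- The contraction of the edge from `i` to `j`: the vertex `j` is merged into `i`, and the new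
vertex `i` carries the product of the two labels. -/
def LGraph.contract (g : LGraph W) (i j : ℕ) : LGraph W where
  verts := g.verts.erase j
  edges := (g.edges.erase (i, j)).map (Prod.map (collapse i j) (collapse i j))
  deg := Function.update g.deg i (g.deg i + g.deg j)
  lab := Function.update g.lab i (g.lab i * g.lab j)

/-- The exponent of the sign with which `LGraph.contract` computes `μ_e` for the edge `e` from `i` to
`j`: the sign of moving the factor at `i` to the front and the factor at `j` to the second place,
the sign `(-1) ^ |a|` of `a ⊗ b ↦ (-1) ^ |a| a b`, and the sign of moving the product from the
front back to the place of `i`. -/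
def contractExp (S : Finset ℕ) (p : ℕ → ℤ) (i j : ℕ) : ℤ :=
  (p i - 1) * before S p i + (p j - 1) * before (S.erase i) p j + p i +
    (p i + p j - 1) * before (S.erase j) p i

/-- The map `μ_e` for the edge `e` from `i` to `j`. -/
def CDGA.mu (A : CDGA W) (g : LGraph W) (i j : ℕ) : A.LieCoalg :=
  sgn (contractExp g.verts g.deg i j) • A.gen (g.contract i j)

/-- The differential of `W` applied to the label of the vertex `k`, with its Koszul sign. -/
def CDGA.dAt (A : CDGA W) (g : LGraph W) (k : ℕ) : A.LieCoalg :=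
  sgn (before g.verts g.deg k) • A.gen ⟨g.verts, g.edges, Function.update g.deg k (g.deg k + 1),
    Function.update g.lab k (A.d (g.lab k))⟩

open Classical in
/-- The value of `d_W` on a labelled graph. -/
def CDGA.dWFun (A : CDGA W) (g : LGraph W) : A.LieCoalg :=
  if A.Valid g then ∑ k ∈ g.verts, A.dAt g k else 0

open Classical in
/-- The value of `d_μ` on a labelled graph. -/
def CDGA.dMuFun (A : CDGA W) (g : LGraph W) : A.LieCoalg :=
  if A.Valid g then (g.edges.map fun e => A.mu g e.1 e.2).sum else 0

theorem CDGA.Valid.update {A : CDGA W} {S : Finset ℕ} {E : Multiset (ℕ × ℕ)} {p : ℕ → ℤ}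
    {w : ℕ → W} {k : ℕ} {n : ℤ} {x : W} (h : A.Valid ⟨S, E, p, w⟩) (hx : x ∈ A.gr n) :
    A.Valid ⟨S, E, Function.update p k n, Function.update w k x⟩ := by
  refine ⟨h.1, fun l hl => ?_⟩
  rcases eq_or_ne l k with rfl | hne
  · simpa using hx
  · have := h.2 l hl
    simpa [hne] using this

theorem CDGA.Valid.update' {A : CDGA W} {S : Finset ℕ} {E : Multiset (ℕ × ℕ)} {p : ℕ → ℤ}
    {w : ℕ → W} {k : ℕ} {x y : W} (h : A.Valid ⟨S, E, p, Function.update w k x⟩)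
    (hy : y ∈ A.gr (p k)) : A.Valid ⟨S, E, p, Function.update w k y⟩ := by
  have := h.update (k := k) hy
  simpa using this

theorem CDGA.Valid.mem {A : CDGA W} {g : LGraph W} (h : A.Valid g) {k : ℕ} (hk : k ∈ g.verts) :
    g.lab k ∈ A.gr (g.deg k) := h.2 k hk

theorem CDGA.Valid.contract {A : CDGA W} {g : LGraph W} (h : A.Valid g) {i j : ℕ}
    (he : (i, j) ∈ g.edges) : A.Valid (g.contract i j) := by
  refine ⟨h.1.contract he, fun l hl => ?_⟩
  have hl' := Finset.mem_erase.1 hl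
  have hm := h.1.mem _ he
  rcases eq_or_ne l i with rfl | hne
  · simpa [LGraph.contract] using A.mul_mem (h.2 _ hm.1) (h.2 _ hm.2)
  · simpa [LGraph.contract, hne] using h.2 l hl'.2

/-- `dAt` is multilinear in the labels. -/
theorem CDGA.dAt_update (A : CDGA W) {S : Finset ℕ} {E : Multiset (ℕ × ℕ)} {p : ℕ → ℤ}
    {w : ℕ → W} {k l : ℕ} (hk : k ∈ S) :
    ∃ (c : ℚ) (S' : Finset ℕ) (E' : Multiset (ℕ × ℕ)) (p' : ℕ → ℤ) (w' : ℕ → W) (m : ℕ)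
      (B : W →ₗ[ℚ] W), m ∈ S' ∧ (∀ x ∈ A.gr (p k), B x ∈ A.gr (p' m)) ∧ ∀ x,
        A.dAt ⟨S, E, p, Function.update w k x⟩ l =
          c • A.gen ⟨S', E', p', Function.update w' m (B x)⟩ := by
  rcases eq_or_ne l k with rfl | hne
  · exact ⟨sgn (before S p l), S, E, Function.update p l (p l + 1), w, l, A.d, hk,
      fun x hx => by simpa using A.d_mem hx, fun x => by simp [dAt]⟩
  · exact ⟨sgn (before S p l), S, E, Function.update p l (p l + 1),
      Function.update w l (A.d (w l)), k, LinearMap.id, hk,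
      fun x hx => by simpa [hne.symm] using hx, fun x => by
        simp [dAt, hne, Function.update_comm hne.symm]⟩

/-- `mu` is multilinear in the labels. -/
theorem CDGA.mu_update (A : CDGA W) {S : Finset ℕ} {E : Multiset (ℕ × ℕ)} {p : ℕ → ℤ}
    {w : ℕ → W} {k i j : ℕ} (hk : k ∈ S) (hi : i ∈ S) (hij : i ≠ j)
    (hwi : k ≠ i → w i ∈ A.gr (p i)) (hwj : k ≠ j → w j ∈ A.gr (p j)) :
    ∃ (c : ℚ) (S' : Finset ℕ) (E' : Multiset (ℕ × ℕ)) (p' : ℕ → ℤ) (w' : ℕ → W) (m : ℕ)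
      (B : W →ₗ[ℚ] W), m ∈ S' ∧ (∀ x ∈ A.gr (p k), B x ∈ A.gr (p' m)) ∧ ∀ x,
        A.mu ⟨S, E, p, Function.update w k x⟩ i j =
          c • A.gen ⟨S', E', p', Function.update w' m (B x)⟩ := by
  have hi' : i ∈ S.erase j := Finset.mem_erase.2 ⟨hij, hi⟩
  rcases eq_or_ne k i with rfl | hki
  · refine ⟨sgn (contractExp S p k j), S.erase j,
      (E.erase (k, j)).map (Prod.map (collapse k j) (collapse k j)),
      Function.update p k (p k + p j), w, k, LinearMap.mulRight ℚ (w j), hi',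
      fun x hx => by simpa using A.mul_mem hx (hwj hij), fun x => ?_⟩
    simp only [mu, LGraph.contract]
    simp [hij.symm]
  rcases eq_or_ne k j with rfl | hkj
  · refine ⟨sgn (contractExp S p i k), S.erase k,
      (E.erase (i, k)).map (Prod.map (collapse i k) (collapse i k)), Function.update p i (p i + p k), w, i, LinearMap.mulLeft ℚ (w i), hi',
      fun x hx => by simpa using A.mul_mem (hwi hki) hx, fun x => ?_⟩
    simp only [mu, LGraph.contract]
    congr 1
    refine A.gen_congr (fun _ _ => rfl) fun l hl => ?_
    have := Finset.ne_of_mem_erase hl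
    rcases eq_or_ne l i with rfl | hli
    · simp [hij]
    · simp [hli, this]
  · refine ⟨sgn (contractExp S p i j), S.erase j,
      (E.erase (i, j)).map (Prod.map (collapse i j) (collapse i j)),
      Function.update p i (p i + p j), Function.update w i (w i * w j), k,
      LinearMap.id, Finset.mem_erase.2 ⟨hkj, hk⟩, fun x hx => by simpa [hki] using hx, fun x => ?_⟩
    simp only [mu, LGraph.contract]
    simp [Ne.symm hki, Ne.symm hkj, Function.update_comm hki]

theorem CDGA.dAt_relabel (A : CDGA W) {S : Finset ℕ} {E : Multiset (ℕ × ℕ)} {p p' : ℕ → ℤ}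
    {w w' : ℕ → W} {σ : ℕ → ℕ}
    (hσ : Set.InjOn σ S) (hp : ∀ k ∈ S, p' (σ k) = p k) (hw : ∀ k ∈ S, w' (σ k) = w k)
    (h : A.Valid ⟨S, E, p, w⟩) {k : ℕ} (hk : k ∈ S) :
    A.dAt ⟨S, E, p, w⟩ k = sgn (koszul S p σ) •
      A.dAt ⟨S.image σ, E.map (Prod.map σ σ), p', w'⟩ (σ k) := by
  simp only [dAt]
  have hne : ∀ l ∈ S, l ≠ k → σ l ≠ σ k := fun l hl hlk hc => hlk (hσ hl hk hc)
  rw [A.gen_relabel (σ := σ) (p' := Function.update p' (σ k) (p' (σ k) + 1))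
    (w' := Function.update w' (σ k) (A.d (w' (σ k)))) hσ ?_ ?_ (h.update (A.d_mem (h.2 k hk)))]
  · rw [smul_smul, smul_smul, ← sgn_add, ← sgn_add]
    congr 1
    apply sgn_congr
    rw [koszul_update hk, cross_erase hk]
    push_cast
    rw [before_image hσ hp hk]
    simp
    ring
  · intro l hl
    rcases eq_or_ne l k with rfl | hlk
    · simp [hp l hl]
    · simp [hlk, hne l hl hlk, hp l hl]
  · intro l hl
    rcases eq_or_ne l k with rfl | hlk
    · simp [hw l hl]
    · simp [hlk, hne l hl hlk, hw l hl]


theorem CDGA.mu_relabel (A : CDGA W) {S : Finset ℕ} {E : Multiset (ℕ × ℕ)} {p p' : ℕ → ℤ}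
    {w w' : ℕ → W} {σ : ℕ → ℕ}
    (hσ : Set.InjOn σ S) (hp : ∀ k ∈ S, p' (σ k) = p k) (hw : ∀ k ∈ S, w' (σ k) = w k)
    (h : A.Valid ⟨S, E, p, w⟩) {i j : ℕ} (he : (i, j) ∈ E) :
    A.mu ⟨S, E, p, w⟩ i j = sgn (koszul S p σ) •
      A.mu ⟨S.image σ, E.map (Prod.map σ σ), p', w'⟩ (σ i) (σ j) := by
  have hi : i ∈ S := (h.1.mem _ he).1
  have hj : j ∈ S := (h.1.mem _ he).2
  have hij : i ≠ j := h.1.ne he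
  have hne : ∀ l ∈ S, ∀ k ∈ S, l ≠ k → σ l ≠ σ k := fun l hl k hk hlk hc => hlk (hσ hl hk hc)
  have hσij := hne i hi j hj hij
  simp only [mu]
  have hc := h.contract he
  simp only [LGraph.contract] at hc ⊢
  have hσ' : Set.InjOn σ (S.erase j) := hσ.mono (by simp)
  rw [A.gen_relabel (σ := σ) (p' := Function.update p' (σ i) (p' (σ i) + p' (σ j)))
    (w' := Function.update w' (σ i) (w' (σ i) * w' (σ j))) hσ' ?_ ?_ hc]
  · have hS : (S.erase j).image σ = (S.image σ).erase (σ j) := by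
      ext x
      simp only [Finset.mem_image, Finset.mem_erase]
      constructor
      · rintro ⟨l, ⟨hlj, hl⟩, rfl⟩
        exact ⟨hne l hl j hj hlj, l, hl, rfl⟩
      · rintro ⟨hx, l, hl, rfl⟩
        exact ⟨l, ⟨fun hlj => hx (by rw [hlj]), hl⟩, rfl⟩
    have hE : ((E.erase (i, j)).map (Prod.map (collapse i j) (collapse i j))).map (Prod.map σ σ) =
        ((E.map (Prod.map σ σ)).erase (σ i, σ j)).map
          (Prod.map (collapse (σ i) (σ j)) (collapse (σ i) (σ j))) := by
      rw [show (σ i, σ j) = Prod.map σ σ (i, j) from rfl, ← Multiset.map_erase_of_mem _ _ he,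
        Multiset.map_map, Multiset.map_map]
      refine Multiset.map_congr rfl fun e he' => ?_
      have hm := h.1.mem e (Multiset.mem_of_mem_erase he')
      have key : ∀ x ∈ S, σ (collapse i j x) = collapse (σ i) (σ j) (σ x) := by
        intro x hx
        by_cases hxj : x = j
        · simp [collapse, hxj]
        · simp [collapse, hxj, hne x hx j hj hxj]
      exact Prod.ext (key _ hm.1) (key _ hm.2)
    rw [hS, hE, smul_smul, smul_smul, ← sgn_add, ← sgn_add]
    congr 1
    apply sgn_congr
    have hi' : i ∈ S.erase j := Finset.mem_erase.2 ⟨hij, hi⟩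
    have hj' : j ∈ S.erase i := Finset.mem_erase.2 ⟨hij.symm, hj⟩
    have hσi : σ i ∈ S.image σ := Finset.mem_image_of_mem _ hi
    have hσj : σ j ∈ S.image σ := Finset.mem_image_of_mem _ hj
    simp only [contractExp]
    rw [koszul_update hi', koszul_erase hj, cross_erase hi', cross_erase hj, cross_erase hj,
      before_erase hi, before_erase hj, before_erase hσi, before_erase hσj, hp i hi, hp j hj]
    push_cast
    rw [before_image hσ hp hi, before_image hσ hp hj]
    generalize (koszul S p σ : ZMod 2) = K
    generalize (cross S p σ i : ZMod 2) = ci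
    generalize (cross S p σ j : ZMod 2) = cj
    generalize (before S p i : ZMod 2) = bi
    generalize (before S p j : ZMod 2) = bj
    rcases lt_or_gt_of_ne hij with h1 | h1 <;> rcases lt_or_gt_of_ne hσij with h2 | h2 <;>
      simp only [h1, h2, h1.not_gt, h2.not_gt, lt_self_iff_false, and_false, false_and, or_false,
        false_or, and_true, true_and, or_self, if_true, if_false, hp i hi, hp j hj] <;>
      push_cast <;>
      generalize (p i : ZMod 2) = pi <;> generalize (p j : ZMod 2) = pj <;>
      revert K ci cj bi bj pi pj <;> decide
  · intro l hl
    have hl' := Finset.mem_of_mem_erase hl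
    rcases eq_or_ne l i with rfl | hlk
    · simp [hp l hl', hp j hj]
    · simp [hlk, hne l hl' i hi hlk, hp l hl']
  · intro l hl
    have hl' := Finset.mem_of_mem_erase hl
    rcases eq_or_ne l i with rfl | hlk
    · simp [hw l hl', hw j hj]
    · simp [hlk, hne l hl' i hi hlk, hw l hl']

theorem collapse_comp (a b x : ℕ) : collapse a b (collapse b a x) = collapse a b x := by
  unfold collapse
  split_ifs <;> simp_all

theorem CDGA.mu_swap (A : CDGA W) {S : Finset ℕ} {E : Multiset (ℕ × ℕ)} {p : ℕ → ℤ}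
    {w : ℕ → W} {a b : ℕ} (h : A.Valid ⟨S, (a, b) ::ₘ E, p, w⟩) :
    A.mu ⟨S, (a, b) ::ₘ E, p, w⟩ a b = -A.mu ⟨S, (b, a) ::ₘ E, p, w⟩ b a := by
  have hm := h.1.mem (a, b) (by simp)
  have ha : a ∈ S := hm.1
  have hb : b ∈ S := hm.2
  have hab : a ≠ b := h.1.ne (e := (a, b)) (by simp)
  have hr : A.Valid ⟨S, (b, a) ::ₘ E, p, w⟩ := ⟨IsTree.reverse h.1, h.2⟩
  have hc := hr.contract (i := b) (j := a) (by simp)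
  have ha' : a ∈ S.erase b := Finset.mem_erase.2 ⟨hab, ha⟩
  have hb' : b ∈ S.erase a := Finset.mem_erase.2 ⟨hab.symm, hb⟩
  simp only [mu, LGraph.contract, Multiset.erase_cons_head] at hc ⊢
  have hσ : Set.InjOn (collapse a b) (S.erase a) := by
    intro x hx y hy hxy
    have hx' := Finset.ne_of_mem_erase (Finset.mem_coe.1 hx)
    have hy' := Finset.ne_of_mem_erase (Finset.mem_coe.1 hy)
    simp only [collapse] at hxy
    split_ifs at hxy <;> simp_all
  have hp : ∀ k ∈ S.erase a, Function.update p a (p a + p b) (collapse a b k) =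
      Function.update p b (p b + p a) k := by
    intro k hk
    have hk' := Finset.ne_of_mem_erase hk
    by_cases hkb : k = b
    · simp [collapse, hkb, add_comm]
    · simp [collapse, hkb, hk']
  rw [A.gen_relabel (p' := Function.update p a (p a + p b))
    (w' := Function.update w a (sgn (p b * p a) • (w a * w b))) hσ hp ?_ hc]
  · have hS : (S.erase a).image (collapse a b) = S.erase b := by
      ext x
      simp only [Finset.mem_image, Finset.mem_erase]
      constructor
      · rintro ⟨l, ⟨hla, hl⟩, rfl⟩
        by_cases hlb : l = b
        · simp [collapse, hlb, hab, ha]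
        · simp [collapse, hlb, hl]
      · rintro ⟨hx, hxS⟩
        by_cases hxa : x = a
        · exact ⟨b, ⟨hab.symm, hb⟩, by simp [collapse, hxa]⟩
        · exact ⟨x, ⟨hxa, hxS⟩, by simp [collapse, hx]⟩
    have hE : (E.map (Prod.map (collapse b a) (collapse b a))).map
        (Prod.map (collapse a b) (collapse a b)) =
        E.map (Prod.map (collapse a b) (collapse a b)) := by
      rw [Multiset.map_map]
      exact Multiset.map_congr rfl fun e _ => Prod.ext (collapse_comp _ _ _) (collapse_comp _ _ _)
    have hcr : (cross (S.erase a) (Function.update p b (p b + p a)) (collapse a b) b : ZMod 2) =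
        before (S.erase b) p a - before (S.erase a) p b := by
      have h1 := before_image hσ hp hb'
      have h2 : collapse a b b = a := by simp [collapse]
      rw [h2, hS, before_update ha', before_update hb'] at h1
      simp only [lt_self_iff_false, if_false, add_zero] at h1
      rw [h1]; ring
    have hcr2 : cross (S.erase a) (Function.update p b (p b + p a)) (collapse a b) b =
        cross ((S.erase a).erase b) p (collapse a b) b := by
      have h1 := cross_erase hb' (Function.update p b (p b + p a)) (collapse a b) b
      simp only [lt_self_iff_false, false_and, or_self, if_false, sub_zero] at h1
      rw [← h1]
      exact cross_congr (fun k hk => by simp [Finset.ne_of_mem_erase hk]) _ _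
    have hk0 : koszul ((S.erase a).erase b) p (collapse a b) = 0 :=
      koszul_eq_zero p fun k hk => by simp [collapse, Finset.ne_of_mem_erase hk]
    have hk1 := koszul_erase hb' p (collapse a b)
    rw [hS, hE, A.gen_smul (p := Function.update p a (p a + p b)) _ ha'
      (by simpa using A.mul_mem (h.2 a ha) (h.2 b hb)), smul_smul, smul_smul, ← sgn_add, ← sgn_add,
      ← neg_smul, neg_sgn]
    congr 1
    apply sgn_congr
    rw [hk0] at hk1
    rw [koszul_update hb', show koszul (S.erase a) p (collapse a b) =
      (p b - 1) * cross ((S.erase a).erase b) p (collapse a b) b by linarith, ← hcr2]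
    simp only [contractExp]
    push_cast
    rw [hcr, before_erase ha, before_erase hb]
    push_cast
    generalize (before S p a : ZMod 2) = bi
    generalize (before S p b : ZMod 2) = bj
    rcases lt_or_gt_of_ne hab with h1 | h1 <;>
      simp only [h1, h1.not_gt, if_true, if_false, lt_self_iff_false, Int.cast_zero] <;>
      push_cast <;>
      generalize (p a : ZMod 2) = pi <;> generalize (p b : ZMod 2) = pj <;>
      revert bi bj pi pj <;> decide
  · intro k hk
    have hk' := Finset.ne_of_mem_erase hk
    by_cases hkb : k = b
    · simpa [collapse, hkb] using (A.mul_comm (h.2 b hb) (h.2 a ha)).symm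
    · simp [collapse, hkb, hk']

theorem CDGA.dW_rel (A : CDGA W) (x : LGraph W →₀ ℚ) (hx : A.Rel x) :
    Finsupp.linearCombination ℚ A.dWFun x = 0 := by
  cases hx with
  | invalid g hg => simp [dWFun, hg]
  | add S E p w k x y hk hx hy =>
    have hx' : x ∈ A.gr (p k) := by simpa using hx.2 k hk
    have hy' : y ∈ A.gr (p k) := by simpa using hy.2 k hk
    have hxy := hx.update' (add_mem hx' hy')
    simp only [map_sub, Finsupp.linearCombination_single, one_smul, dWFun, if_pos hx, if_pos hy,
      if_pos hxy]
    rw [← Finset.sum_sub_distrib, ← Finset.sum_sub_distrib]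
    refine Finset.sum_eq_zero fun l _ => ?_
    obtain ⟨c, S', E', p', w', m, B, hm, hB, h⟩ := A.dAt_update (E := E) (p := p) (w := w) (l := l) hk
    rw [h, h, h, map_add, A.gen_add hm (hB x hx') (hB y hy'), smul_add]
    abel
  | smul S E p w k c x hk hx =>
    have hx' : x ∈ A.gr (p k) := by simpa using hx.2 k hk
    have hcx := hx.update' ((A.gr (p k)).smul_mem c hx')
    simp only [map_sub, map_smul, Finsupp.linearCombination_single, one_smul, dWFun, if_pos hx,
      if_pos hcx]
    rw [Finset.smul_sum, ← Finset.sum_sub_distrib]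
    refine Finset.sum_eq_zero fun l _ => ?_
    obtain ⟨c, S', E', p', w', m, B, hm, hB, h⟩ := A.dAt_update (E := E) (p := p) (w := w) (l := l) hk
    rw [h, h, map_smul, A.gen_smul _ hm (hB x hx'), smul_comm, sub_self]
  | relabel S E p p' w w' σ hσ hp hw h =>
    have h' : A.Valid ⟨S.image σ, E.map (Prod.map σ σ), p', w'⟩ := by
      refine ⟨IsTree.map h.1 hσ, fun k hk => ?_⟩
      obtain ⟨l, hl, rfl⟩ := Finset.mem_image.1 hk
      have := h.2 l hl
      simp only at this ⊢
      rwa [hp l hl, hw l hl]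
    simp only [map_sub, map_smul, Finsupp.linearCombination_single, one_smul, dWFun, if_pos h,
      if_pos h']
    rw [Finset.sum_image hσ, Finset.smul_sum, ← Finset.sum_sub_distrib]
    exact Finset.sum_eq_zero fun l hl => sub_eq_zero.2 (A.dAt_relabel hσ hp hw h hl)
  | reverse S E p w a b h =>
    have h' : A.Valid ⟨S, (b, a) ::ₘ E, p, w⟩ := ⟨IsTree.reverse h.1, h.2⟩
    simp only [map_add, Finsupp.linearCombination_single, one_smul, dWFun, if_pos h, if_pos h']
    rw [← Finset.sum_add_distrib]
    refine Finset.sum_eq_zero fun l _ => ?_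
    simp only [dAt]
    rw [A.gen_reverse S E _ _ a b, smul_neg, neg_add_cancel]
  | arnold S E p w a b c h =>
    have h2 : A.Valid ⟨S, (b, c) ::ₘ (c, a) ::ₘ E, p, w⟩ := ⟨IsTree.rotate h.1, h.2⟩
    have h3 : A.Valid ⟨S, (c, a) ::ₘ (a, b) ::ₘ E, p, w⟩ := ⟨IsTree.rotate h2.1, h.2⟩
    simp only [map_add, Finsupp.linearCombination_single, one_smul, dWFun, if_pos h, if_pos h2,
      if_pos h3]
    rw [← Finset.sum_add_distrib, ← Finset.sum_add_distrib]
    refine Finset.sum_eq_zero fun l _ => ?_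
    simp only [dAt]
    rw [← smul_add, ← smul_add, A.gen_arnold, smul_zero]

theorem sum_map_eq_zero {α M : Type*} [AddCommGroup M] {s : Multiset α} {f : α → M}
    (h : ∀ a ∈ s, f a = 0) : (s.map f).sum = 0 := by
  rw [Multiset.map_congr rfl h]; simp

theorem CDGA.dMu_rel (A : CDGA W) (x : LGraph W →₀ ℚ) (hx : A.Rel x) :
    Finsupp.linearCombination ℚ A.dMuFun x = 0 := by
  cases hx with
  | invalid g hg => simp [dMuFun, hg]
  | add S E p w k x y hk hx hy =>
    have hx' : x ∈ A.gr (p k) := by simpa using hx.2 k hk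
    have hy' : y ∈ A.gr (p k) := by simpa using hy.2 k hk
    have hxy := hx.update' (add_mem hx' hy')
    simp only [map_sub, Finsupp.linearCombination_single, one_smul, dMuFun, if_pos hx, if_pos hy,
      if_pos hxy]
    rw [← Multiset.sum_map_sub, ← Multiset.sum_map_sub]
    refine sum_map_eq_zero fun e he => ?_
    have hm := hx.1.mem e he
    obtain ⟨c, S', E', p', w', m, B, hm, hB, h⟩ := A.mu_update (E := E) (p := p) (w := w) hk hm.1
      (hx.1.ne he) (fun hk => by simpa [hk.symm] using hx.2 _ hm.1)
      (fun hk => by simpa [hk.symm] using hx.2 _ hm.2)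
    rw [h, h, h, map_add, A.gen_add hm (hB x hx') (hB y hy'), smul_add]
    abel
  | smul S E p w k c x hk hx =>
    have hx' : x ∈ A.gr (p k) := by simpa using hx.2 k hk
    have hcx := hx.update' ((A.gr (p k)).smul_mem c hx')
    simp only [map_sub, map_smul, Finsupp.linearCombination_single, one_smul, dMuFun, if_pos hx,
      if_pos hcx]
    rw [Multiset.smul_sum, Multiset.map_map, ← Multiset.sum_map_sub]
    refine sum_map_eq_zero fun e he => ?_
    have hm := hx.1.mem e he
    obtain ⟨c, S', E', p', w', m, B, hm, hB, h⟩ := A.mu_update (E := E) (p := p) (w := w) hk hm.1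
      (hx.1.ne he) (fun hk => by simpa [hk.symm] using hx.2 _ hm.1)
      (fun hk => by simpa [hk.symm] using hx.2 _ hm.2)
    rw [Function.comp_apply, h, h, map_smul, A.gen_smul _ hm (hB x hx'), smul_comm, sub_self]
  | relabel S E p p' w w' σ hσ hp hw h =>
    have h' : A.Valid ⟨S.image σ, E.map (Prod.map σ σ), p', w'⟩ := by
      refine ⟨IsTree.map h.1 hσ, fun k hk => ?_⟩
      obtain ⟨l, hl, rfl⟩ := Finset.mem_image.1 hk
      have := h.2 l hl
      simp only at this ⊢
      rwa [hp l hl, hw l hl]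
    simp only [map_sub, map_smul, Finsupp.linearCombination_single, one_smul, dMuFun, if_pos h,
      if_pos h', Multiset.map_map]
    rw [Multiset.smul_sum, Multiset.map_map, ← Multiset.sum_map_sub]
    exact sum_map_eq_zero fun e he => sub_eq_zero.2 (A.mu_relabel hσ hp hw h he)
  | reverse S E p w a b h =>
    have h' : A.Valid ⟨S, (b, a) ::ₘ E, p, w⟩ := ⟨IsTree.reverse h.1, h.2⟩
    simp only [map_add, Finsupp.linearCombination_single, one_smul, dMuFun, if_pos h, if_pos h',
      Multiset.map_cons, Multiset.sum_cons]
    rw [add_add_add_comm, A.mu_swap h, neg_add_cancel, zero_add, ← Multiset.sum_map_add]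
    refine sum_map_eq_zero fun e he => ?_
    simp only [mu, LGraph.contract]
    rw [Multiset.erase_cons_tail_of_mem he, Multiset.erase_cons_tail_of_mem he, Multiset.map_cons,
      Multiset.map_cons, Prod.map_apply, Prod.map_apply, A.gen_reverse, smul_neg, neg_add_cancel]
  | arnold S E p w a b c h =>
    have h2 : A.Valid ⟨S, (b, c) ::ₘ (c, a) ::ₘ E, p, w⟩ := ⟨IsTree.rotate h.1, h.2⟩
    have h3 : A.Valid ⟨S, (c, a) ::ₘ (a, b) ::ₘ E, p, w⟩ := ⟨IsTree.rotate h2.1, h.2⟩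
    have hab : a ≠ b := h.1.ne (e := (a, b)) (by simp)
    have hbc : b ≠ c := h.1.ne (e := (b, c)) (by simp)
    have hca : c ≠ a := h2.1.ne (e := (c, a)) (by simp)
    -- the contractions of one edge of the triangle cancel in pairs
    have key : ∀ x y z : ℕ, x ≠ y → y ≠ z → z ≠ x →
        A.mu ⟨S, (x, y) ::ₘ (y, z) ::ₘ E, p, w⟩ x y +
          A.mu ⟨S, (z, x) ::ₘ (x, y) ::ₘ E, p, w⟩ x y = 0 := by
      intro x y z hxy hyz hzx
      simp only [mu, LGraph.contract]
      rw [Multiset.cons_swap (z, x) (x, y), Multiset.erase_cons_head, Multiset.erase_cons_head,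
        Multiset.map_cons, Multiset.map_cons, Prod.map_apply, Prod.map_apply,
        show collapse x y y = x by simp [collapse], show collapse x y z = z by
          simp [collapse, hyz.symm], show collapse x y x = x by simp [collapse],
        A.gen_reverse, smul_neg, neg_add_cancel]
    have k1 := key a b c hab hbc hca
    have k2 := key b c a hbc hca hab
    have k3 := key c a b hca hab hbc
    simp only [map_add, Finsupp.linearCombination_single, one_smul, dMuFun, if_pos h, if_pos h2,
      if_pos h3, Multiset.map_cons, Multiset.sum_cons]
    have k0 : (E.map fun e => A.mu ⟨S, (a, b) ::ₘ (b, c) ::ₘ E, p, w⟩ e.1 e.2).sum +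
        (E.map fun e => A.mu ⟨S, (b, c) ::ₘ (c, a) ::ₘ E, p, w⟩ e.1 e.2).sum +
        (E.map fun e => A.mu ⟨S, (c, a) ::ₘ (a, b) ::ₘ E, p, w⟩ e.1 e.2).sum = 0 := by
      rw [← Multiset.sum_map_add, ← Multiset.sum_map_add]
      refine sum_map_eq_zero fun e he => ?_
      simp only [mu, LGraph.contract]
      have hE : ∀ x y : ℕ × ℕ, (x ::ₘ y ::ₘ E).erase e = x ::ₘ y ::ₘ E.erase e := by
        intro x y
        rw [Multiset.erase_cons_tail_of_mem (Multiset.mem_cons_of_mem he),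
          Multiset.erase_cons_tail_of_mem he]
      rw [hE, hE, hE]
      simp only [Multiset.map_cons, Prod.map_apply]
      rw [← smul_add, ← smul_add, A.gen_arnold, smul_zero]
    have e := congrArg₂ (· + ·) (congrArg₂ (· + ·) k0 k1) (congrArg₂ (· + ·) k2 k3)
    simp only [add_zero] at e
    rw [← e]
    abel

/-- The differential `d_W` of `𝔼(W)` that extends the differential of `W`. -/
def CDGA.dW (A : CDGA W) : A.LieCoalg →ₗ[ℚ] A.LieCoalg :=
  A.relations.liftQ (Finsupp.linearCombination ℚ A.dWFun) (A.lift_aux A.dWFun A.dW_rel)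

/-- The differential `d_μ` of `𝔼(W)`, the sum over the edges `e` of the contractions `μ_e`. -/
def CDGA.dMu (A : CDGA W) : A.LieCoalg →ₗ[ℚ] A.LieCoalg :=
  A.relations.liftQ (Finsupp.linearCombination ℚ A.dMuFun) (A.lift_aux A.dMuFun A.dMu_rel)

theorem CDGA.dW_gen (A : CDGA W) {g : LGraph W} (hg : A.Valid g) :
    A.dW (A.gen g) = ∑ k ∈ g.verts, A.dAt g k := by
  simp [dW, gen, dWFun, hg]

theorem CDGA.dMu_gen (A : CDGA W) {g : LGraph W} (hg : A.Valid g) :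
    A.dMu (A.gen g) = (g.edges.map fun e => A.mu g e.1 e.2).sum := by
  simp [dMu, gen, dMuFun, hg]

/-! ### The square of the total differential is zero -/

theorem CDGA.hom_ext (A : CDGA W) {M : Type*} [AddCommGroup M] [Module ℚ M]
    {f f' : A.LieCoalg →ₗ[ℚ] M} (h : ∀ g, A.Valid g → f (A.gen g) = f' (A.gen g)) : f = f' := by
  apply Submodule.linearMap_qext
  apply Finsupp.lhom_ext'
  intro g
  apply LinearMap.ext_ring
  by_cases hg : A.Valid g
  · exact h g hg
  · change f (A.gen g) = f' (A.gen g)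
    rw [A.gen_invalid hg, map_zero, map_zero]

theorem eq_zero_of_add_self {M : Type*} [AddCommGroup M] [Module ℚ M] {x : M} (h : x + x = 0) :
    x = 0 := by
  have : (2 : ℚ) • x = 0 := by rw [two_smul, h]
  simpa using this

theorem sum_sum_antisymm {M : Type*} [AddCommGroup M] [Module ℚ M] (S : Finset ℕ)
    (F : ℕ → ℕ → M) (h : ∀ k ∈ S, ∀ l ∈ S, F k l + F l k = 0) : ∑ k ∈ S, ∑ l ∈ S, F k l = 0 := by
  apply eq_zero_of_add_self
  nth_rewrite 2 [Finset.sum_comm]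
  rw [← Finset.sum_add_distrib]
  refine Finset.sum_eq_zero fun k hk => ?_
  rw [← Finset.sum_add_distrib]
  exact Finset.sum_eq_zero fun l hl => h k hk l hl

theorem sum_erase_antisymm {α M : Type*} [DecidableEq α] [AddCommGroup M] (s : Multiset α)
    (F : α → α → M) (h : ∀ a ∈ s, ∀ b ∈ s.erase a, F a b + F b a = 0) :
    (s.map fun a => ((s.erase a).map (F a)).sum).sum = 0 := by
  induction s using Multiset.induction with
  | empty => simp
  | cons a s ih =>
    have ih' := ih (fun b hb c hc => h b (Multiset.mem_cons_of_mem hb) c (by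
      rw [Multiset.erase_cons_tail_of_mem hb]; exact Multiset.mem_cons_of_mem hc))
    rw [Multiset.map_cons, Multiset.sum_cons, Multiset.erase_cons_head]
    have : (s.map fun b => (((a ::ₘ s).erase b).map (F b)).sum) =
        s.map fun b => F b a + ((s.erase b).map (F b)).sum := by
      refine Multiset.map_congr rfl fun b hb => ?_
      rw [Multiset.erase_cons_tail_of_mem hb, Multiset.map_cons, Multiset.sum_cons]
    rw [this, Multiset.sum_map_add, ih', add_zero, ← Multiset.sum_map_add]
    refine sum_map_eq_zero fun b hb => h a (by simp) b ?_
    rwa [Multiset.erase_cons_head]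

theorem CDGA.dW_dAt (A : CDGA W) {g : LGraph W} (hg : A.Valid g) {k : ℕ} (hk : k ∈ g.verts) :
    A.dW (A.dAt g k) = ∑ l ∈ g.verts, sgn (before g.verts g.deg k) •
      A.dAt ⟨g.verts, g.edges, Function.update g.deg k (g.deg k + 1),
        Function.update g.lab k (A.d (g.lab k))⟩ l := by
  have h : A.Valid ⟨g.verts, g.edges, Function.update g.deg k (g.deg k + 1),
        Function.update g.lab k (A.d (g.lab k))⟩ :=
    CDGA.Valid.update (S := g.verts) (E := g.edges) hg (A.d_mem (hg.mem hk))
  conv_lhs => rw [dAt, map_smul, A.dW_gen h]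
  rw [Finset.smul_sum]

theorem CDGA.dMu_dAt (A : CDGA W) {g : LGraph W} (hg : A.Valid g) {k : ℕ} (hk : k ∈ g.verts) :
    A.dMu (A.dAt g k) = (g.edges.map fun e => sgn (before g.verts g.deg k) •
      A.mu ⟨g.verts, g.edges, Function.update g.deg k (g.deg k + 1),
        Function.update g.lab k (A.d (g.lab k))⟩ e.1 e.2).sum := by
  have h : A.Valid ⟨g.verts, g.edges, Function.update g.deg k (g.deg k + 1),
        Function.update g.lab k (A.d (g.lab k))⟩ :=
    CDGA.Valid.update (S := g.verts) (E := g.edges) hg (A.d_mem (hg.mem hk))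
  conv_lhs => rw [dAt, map_smul, A.dMu_gen h]
  rw [Multiset.smul_sum, Multiset.map_map]
  rfl

theorem CDGA.gen_zero (A : CDGA W) {S : Finset ℕ} {E : Multiset (ℕ × ℕ)} {p : ℕ → ℤ} {w : ℕ → W}
    {k : ℕ} (hk : k ∈ S) : A.gen ⟨S, E, p, Function.update w k 0⟩ = 0 := by
  have := A.gen_smul (S := S) (E := E) (p := p) (w := w) 0 hk (zero_mem (A.gr (p k)))
  rwa [smul_zero, zero_smul] at this

theorem CDGA.dW_dW (A : CDGA W) : A.dW ∘ₗ A.dW = 0 := by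
  refine A.hom_ext fun g hg => ?_
  rw [LinearMap.comp_apply, A.dW_gen hg, map_sum, LinearMap.zero_apply,
    Finset.sum_congr rfl fun k hk => A.dW_dAt hg hk]
  refine sum_sum_antisymm _ _ fun k hk l hl => ?_
  rcases eq_or_ne k l with rfl | hkl
  · simp only [dAt, Function.update_self, A.d_d]
    rw [A.gen_zero hk]
    simp
  · simp only [dAt, smul_smul, ← sgn_add, Function.update_of_ne hkl, Function.update_of_ne hkl.symm]
    rw [Function.update_comm hkl, Function.update_comm hkl, before_update hk, before_update hl,
      ← add_smul]
    convert zero_smul ℚ _ using 2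
    rw [add_eq_zero_iff_eq_neg, neg_sgn]
    apply sgn_congr
    push_cast
    rcases lt_or_gt_of_ne hkl with h | h <;> simp [h, h.not_gt] <;> ring_nf
    have : (2 : ZMod 2) = 0 := rfl
    simp [this]

theorem CDGA.dAt_contract (A : CDGA W) {g : LGraph W} (hg : A.Valid g) {i j k : ℕ}
    (he : (i, j) ∈ g.edges) (hk : k ∈ g.verts) (hki : k ≠ i) (hkj : k ≠ j) :
    sgn (contractExp g.verts g.deg i j) • A.dAt (g.contract i j) k +
      sgn (before g.verts g.deg k) • A.mu ⟨g.verts, g.edges, Function.update g.deg k (g.deg k + 1),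
        Function.update g.lab k (A.d (g.lab k))⟩ i j = 0 := by
  obtain ⟨S, E, p, w⟩ := g
  have hi : i ∈ S := (hg.1.mem _ he).1
  have hj : j ∈ S := (hg.1.mem _ he).2
  have hij : i ≠ j := hg.1.ne he
  have hi' : i ∈ S.erase j := Finset.mem_erase.2 ⟨hij, hi⟩
  have hk1 : k ∈ S.erase j := Finset.mem_erase.2 ⟨hkj, hk⟩
  have hk2 : k ∈ S.erase i := Finset.mem_erase.2 ⟨hki, hk⟩
  simp only [dAt, mu, LGraph.contract, smul_smul, ← sgn_add, Function.update_of_ne hki,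
    Function.update_of_ne hki.symm, Function.update_of_ne hkj.symm]
  rw [Function.update_comm hki, Function.update_comm hki, ← add_smul]
  convert zero_smul ℚ _ using 2
  rw [add_eq_zero_iff_eq_neg, neg_sgn]
  apply sgn_congr
  simp only [contractExp, Function.update_of_ne hki.symm, Function.update_of_ne hkj.symm]
  rw [before_update hi', before_update hk, before_update hk1, before_update hk2, before_erase hj,
    before_erase hj, before_erase hi]
  push_cast
  generalize (before S p i : ZMod 2) = bi
  generalize (before S p j : ZMod 2) = bj
  generalize (before S p k : ZMod 2) = bk
  rcases lt_or_gt_of_ne hij with h1 | h1 <;> rcases lt_or_gt_of_ne hki with h2 | h2 <;>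
    rcases lt_or_gt_of_ne hkj with h3 | h3 <;>
    simp only [h1, h2, h3, h1.not_gt, h2.not_gt, h3.not_gt, if_true, if_false] <;>
    generalize (p i : ZMod 2) = pi <;> generalize (p j : ZMod 2) = pj <;>
    generalize (p k : ZMod 2) = pk <;>
    revert bi bj bk pi pj pk <;> decide

theorem smul_pair_eq_zero {M : Type*} [AddCommGroup M] [Module ℚ M] {x y : M} {a b c e : ℚ}
    (h1 : a + c = 0) (h2 : b + e = 0) : a • x + b • y + c • x + e • y = 0 := by
  rw [eq_neg_of_add_eq_zero_right h1, eq_neg_of_add_eq_zero_right h2]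
  module

theorem sgn_add_eq_zero {m n : ℤ} (h : (m : ZMod 2) = n + 1) : sgn m + sgn n = 0 := by
  rw [add_eq_zero_iff_eq_neg, neg_sgn]
  apply sgn_congr
  rw [h]; push_cast; rfl

theorem before_update_of_notMem {S : Finset ℕ} {i : ℕ} (hi : i ∉ S) (p : ℕ → ℤ) (v : ℤ) (x : ℕ) :
    before S (Function.update p i v) x = before S p x :=
  before_congr (fun k hk => by simp [ne_of_mem_of_not_mem hk hi]) x

theorem CDGA.leibniz_contract (A : CDGA W) {g : LGraph W} (hg : A.Valid g) {i j : ℕ}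
    (he : (i, j) ∈ g.edges) :
    sgn (contractExp g.verts g.deg i j) • A.dAt (g.contract i j) i +
      sgn (before g.verts g.deg i) • A.mu ⟨g.verts, g.edges, Function.update g.deg i (g.deg i + 1),
        Function.update g.lab i (A.d (g.lab i))⟩ i j +
      sgn (before g.verts g.deg j) • A.mu ⟨g.verts, g.edges, Function.update g.deg j (g.deg j + 1),
        Function.update g.lab j (A.d (g.lab j))⟩ i j = 0 := by
  obtain ⟨S, E, p, w⟩ := g
  have hi : i ∈ S := (hg.1.mem _ he).1
  have hj : j ∈ S := (hg.1.mem _ he).2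
  have hij : i ≠ j := hg.1.ne he
  have hi' : i ∈ S.erase j := Finset.mem_erase.2 ⟨hij, hi⟩
  have hj' : j ∈ S.erase i := Finset.mem_erase.2 ⟨hij.symm, hj⟩
  have hwi : w i ∈ A.gr (p i) := hg.2 i hi
  have hwj : w j ∈ A.gr (p j) := hg.2 j hj
  have m1 : A.d (w i) * w j ∈ A.gr (p i + p j + 1) := by
    have := A.mul_mem (A.d_mem hwi) hwj
    rwa [show p i + 1 + p j = p i + p j + 1 by ring] at this
  have m2 : w i * A.d (w j) ∈ A.gr (p i + p j + 1) := by
    have := A.mul_mem hwi (A.d_mem hwj)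
    rwa [show p i + (p j + 1) = p i + p j + 1 by ring] at this
  simp only [dAt, mu, LGraph.contract, smul_smul, ← sgn_add, Function.update_of_ne hij,
    Function.update_of_ne hij.symm, Function.update_self, Function.update_idem]
  set E' := (E.erase (i, j)).map (Prod.map (collapse i j) (collapse i j))
  have e2 : A.gen ⟨S.erase j, E', Function.update p i (p i + 1 + p j),
      Function.update w i (A.d (w i) * w j)⟩ = A.gen ⟨S.erase j, E',
      Function.update p i (p i + p j + 1), Function.update w i (A.d (w i) * w j)⟩ := by
    rw [show p i + 1 + p j = p i + p j + 1 by ring]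
  have e3 : A.gen ⟨S.erase j, E', Function.update (Function.update p j (p j + 1)) i
      (p i + (p j + 1)), Function.update (Function.update w j (A.d (w j))) i (w i * A.d (w j))⟩ =
      A.gen ⟨S.erase j, E',
      Function.update p i (p i + p j + 1), Function.update w i (w i * A.d (w j))⟩ := by
    rw [show p i + (p j + 1) = p i + p j + 1 by ring]
    refine A.gen_congr (fun l hl => ?_) (fun l hl => ?_) <;>
    · have := Finset.ne_of_mem_erase hl
      by_cases hli : l = i <;> simp [hli, this]
  rw [e2, e3, A.leibniz hwi hwj, A.gen_add (p := Function.update p i (p i + p j + 1)) hi'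
    (by simpa using m1) (by simpa using (A.gr _).smul_mem _ m2),
    A.gen_smul (p := Function.update p i (p i + p j + 1)) _ hi' (by simpa using m2), smul_add,
    smul_smul, ← sgn_add]
  refine smul_pair_eq_zero (sgn_add_eq_zero ?_) (sgn_add_eq_zero ?_)
  all_goals
    simp only [contractExp, Function.update_self, Function.update_of_ne hij,
      Function.update_of_ne hij.symm, before_update hi, before_update hj, before_update hi',
      before_update hj', before_update_of_notMem (Finset.notMem_erase i S),
      before_update_of_notMem (Finset.notMem_erase j S), before_erase hi, before_erase hj,
      lt_self_iff_false, if_false]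
    push_cast
    generalize (before S p i : ZMod 2) = bi
    generalize (before S p j : ZMod 2) = bj
    rcases lt_or_gt_of_ne hij with h1 | h1 <;>
      simp only [h1, h1.not_gt, if_true, if_false] <;>
      generalize (p i : ZMod 2) = pi <;> generalize (p j : ZMod 2) = pj <;>
      revert bi bj pi pj <;> decide

theorem CDGA.dW_dMu (A : CDGA W) : A.dW ∘ₗ A.dMu + A.dMu ∘ₗ A.dW = 0 := by
  refine A.hom_ext fun g hg => ?_
  rw [LinearMap.add_apply, LinearMap.comp_apply, LinearMap.comp_apply, A.dW_gen hg, A.dMu_gen hg,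
    map_sum, LinearMap.zero_apply, Finset.sum_congr rfl fun k hk => A.dMu_dAt hg hk]
  have hswap : ∀ (s : Multiset (ℕ × ℕ)) (F : ℕ → ℕ × ℕ → A.LieCoalg),
      ∑ k ∈ g.verts, (s.map fun e => F k e).sum = (s.map fun e => ∑ k ∈ g.verts, F k e).sum := by
    intro s F
    induction s using Multiset.induction with
    | empty => simp
    | cons a s ih => simp [Finset.sum_add_distrib, ih]
  rw [hswap, map_multiset_sum, Multiset.map_map, ← Multiset.sum_map_add]
  refine sum_map_eq_zero fun e he => ?_
  obtain ⟨i, j⟩ := e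
  have hi := (hg.1.mem _ he).1
  have hj := (hg.1.mem _ he).2
  have hij : i ≠ j := hg.1.ne he
  have hj' : i ∈ g.verts.erase j := Finset.mem_erase.2 ⟨hij, hi⟩
  simp only [Function.comp_apply]
  rw [mu, map_smul, A.dW_gen (hg.contract he), Finset.smul_sum]
  change ∑ k ∈ g.verts.erase j, _ + _ = _
  rw [← Finset.add_sum_erase g.verts _ hj, ← Finset.add_sum_erase (g.verts.erase j) _ hj',
    ← Finset.add_sum_erase (g.verts.erase j) _ hj']
  have h1 := A.leibniz_contract hg he
  have h2 := Finset.sum_eq_zero (s := (g.verts.erase j).erase i) fun k hk => by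
    have hk' := Finset.mem_erase.1 hk
    have hk'' := Finset.mem_erase.1 hk'.2
    exact A.dAt_contract hg he hk''.2 hk'.1 hk''.1
  rw [Finset.sum_add_distrib] at h2
  have e := congrArg₂ (· + ·) h1 h2
  simp only [add_zero] at e
  rw [← e]
  abel

/-- The contraction of two edges, one after the other. -/
def CDGA.mu₂ (A : CDGA W) (g : LGraph W) (e f : ℕ × ℕ) : A.LieCoalg :=
  sgn (contractExp g.verts g.deg e.1 e.2) •
    A.mu (g.contract e.1 e.2) (collapse e.1 e.2 f.1) (collapse e.1 e.2 f.2)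

theorem smul_add_smul_eq_zero {M : Type*} [AddCommGroup M] [Module ℚ M] {x : M} {m n : ℤ}
    (h : (m : ZMod 2) = n + 1) : sgn m • x + sgn n • x = 0 := by
  rw [← add_smul, sgn_add_eq_zero h, zero_smul]

theorem CDGA.mu₂_disjoint (A : CDGA W) {S : Finset ℕ} {E : Multiset (ℕ × ℕ)} {p : ℕ → ℤ}
    {w : ℕ → W} {i j k l : ℕ} (hg : A.Valid ⟨S, (i, j) ::ₘ (k, l) ::ₘ E, p, w⟩)
    (hik : i ≠ k) (hil : i ≠ l) (hjk : j ≠ k) (hjl : j ≠ l) :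
    A.mu₂ ⟨S, (i, j) ::ₘ (k, l) ::ₘ E, p, w⟩ (i, j) (k, l) +
      A.mu₂ ⟨S, (i, j) ::ₘ (k, l) ::ₘ E, p, w⟩ (k, l) (i, j) = 0 := by
  have hij : i ≠ j := hg.1.ne (e := (i, j)) (by simp)
  have hkl : k ≠ l := hg.1.ne (e := (k, l)) (by simp)
  obtain ⟨hi, hj⟩ : i ∈ S ∧ j ∈ S := hg.1.mem (i, j) (by simp)
  obtain ⟨hk, hl⟩ : k ∈ S ∧ l ∈ S := hg.1.mem (k, l) (by simp)
  have c1 : collapse i j k = k := by simp [collapse, hjk.symm]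
  have c2 : collapse i j l = l := by simp [collapse, hjl.symm]
  have c3 : collapse k l i = i := by simp [collapse, hil]
  have c4 : collapse k l j = j := by simp [collapse, hjl]
  have hE : (E.map (Prod.map (collapse i j) (collapse i j))).map
      (Prod.map (collapse k l) (collapse k l)) = (E.map (Prod.map (collapse k l) (collapse k l))).map
      (Prod.map (collapse i j) (collapse i j)) := by
    rw [Multiset.map_map, Multiset.map_map]
    have key : ∀ x, collapse k l (collapse i j x) = collapse i j (collapse k l x) := by
      intro x
      simp only [collapse]
      split_ifs <;> simp_all
    exact Multiset.map_congr rfl fun e _ => Prod.ext (key _) (key _)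
  simp only [mu₂, mu, LGraph.contract, c1, c2, c3, c4, smul_smul, ← sgn_add]
  rw [Multiset.cons_swap (i, j) (k, l), Multiset.erase_cons_head, Multiset.cons_swap (k, l) (i, j),
    Multiset.erase_cons_head, Multiset.map_cons, Multiset.map_cons, Prod.map_apply, Prod.map_apply,
    c1, c2, c3, c4, Multiset.erase_cons_head, Multiset.erase_cons_head, hE,
    Finset.erase_right_comm (a := l) (b := j)]
  simp only [Function.update_of_ne hik, Function.update_of_ne hik.symm, Function.update_of_ne hil,
    Function.update_of_ne hil.symm, Function.update_of_ne hjk, Function.update_of_ne hjk.symm,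
    Function.update_of_ne hjl, Function.update_of_ne hjl.symm, Function.update_of_ne hij.symm,
    Function.update_of_ne hkl.symm]
  rw [Function.update_comm hik, Function.update_comm hik]
  refine smul_add_smul_eq_zero ?_
  have m1 : k ∈ S.erase j := Finset.mem_erase.2 ⟨hjk.symm, hk⟩
  have m2 : l ∈ S.erase j := Finset.mem_erase.2 ⟨hjl.symm, hl⟩
  have m3 : i ∈ S.erase j := Finset.mem_erase.2 ⟨hij, hi⟩
  have m4 : i ∈ S.erase l := Finset.mem_erase.2 ⟨hil, hi⟩
  have m5 : j ∈ S.erase l := Finset.mem_erase.2 ⟨hjl, hj⟩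
  have m6 : k ∈ S.erase l := Finset.mem_erase.2 ⟨hkl, hk⟩
  simp only [contractExp, Function.update_of_ne hik, Function.update_of_ne hik.symm,
    Function.update_of_ne hil, Function.update_of_ne hil.symm, Function.update_of_ne hjk,
    Function.update_of_ne hjk.symm, Function.update_of_ne hjl, Function.update_of_ne hjl.symm,
    before_erase m1, before_erase m2, before_erase m4, before_erase m5, before_update m3,
    before_update m6, before_erase hi, before_erase hj, before_erase hk, before_erase hl]
  push_cast
  generalize (before S p i : ZMod 2) = bi
  generalize (before S p j : ZMod 2) = bj
  generalize (before S p k : ZMod 2) = bk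
  generalize (before S p l : ZMod 2) = bl
  rcases lt_or_gt_of_ne hij with h1 | h1 <;> rcases lt_or_gt_of_ne hik with h2 | h2 <;>
    rcases lt_or_gt_of_ne hil with h3 | h3 <;> rcases lt_or_gt_of_ne hjk with h4 | h4 <;>
    rcases lt_or_gt_of_ne hjl with h5 | h5 <;> rcases lt_or_gt_of_ne hkl with h6 | h6 <;>
    first
    | omega
    | (simp only [h1, h2, h3, h4, h5, h6, h1.not_gt, h2.not_gt, h3.not_gt, h4.not_gt, h5.not_gt,
        h6.not_gt, if_true, if_false, Int.cast_zero, Int.cast_sub, Int.cast_add, Int.cast_one]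
       generalize (p i : ZMod 2) = pi
       generalize (p j : ZMod 2) = pj
       generalize (p k : ZMod 2) = pk
       generalize (p l : ZMod 2) = pl
       clear * -
       revert bi bj bk bl pi pj pk pl
       decide)

theorem CDGA.mu₂_chain (A : CDGA W) {S : Finset ℕ} {E : Multiset (ℕ × ℕ)} {p : ℕ → ℤ}
    {w : ℕ → W} {i j l : ℕ} (hg : A.Valid ⟨S, (i, j) ::ₘ (j, l) ::ₘ E, p, w⟩) (hil : i ≠ l) :
    A.mu₂ ⟨S, (i, j) ::ₘ (j, l) ::ₘ E, p, w⟩ (i, j) (j, l) +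
      A.mu₂ ⟨S, (i, j) ::ₘ (j, l) ::ₘ E, p, w⟩ (j, l) (i, j) = 0 := by
  have hij : i ≠ j := hg.1.ne (e := (i, j)) (by simp)
  have hjl : j ≠ l := hg.1.ne (e := (j, l)) (by simp)
  obtain ⟨hi, hj⟩ : i ∈ S ∧ j ∈ S := hg.1.mem (i, j) (by simp)
  obtain ⟨-, hl⟩ : j ∈ S ∧ l ∈ S := hg.1.mem (j, l) (by simp)
  have c1 : collapse i j j = i := by simp [collapse]
  have c2 : collapse i j l = l := by simp [collapse, hjl.symm]
  have c3 : collapse j l i = i := by simp [collapse, hil]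
  have c4 : collapse j l j = j := by simp [collapse, hjl]
  have hE : (E.map (Prod.map (collapse i j) (collapse i j))).map
      (Prod.map (collapse i l) (collapse i l)) = (E.map (Prod.map (collapse j l) (collapse j l))).map
      (Prod.map (collapse i j) (collapse i j)) := by
    rw [Multiset.map_map, Multiset.map_map]
    have key : ∀ x, collapse i l (collapse i j x) = collapse i j (collapse j l x) := by
      intro x
      simp only [collapse]
      split_ifs <;> simp_all
    exact Multiset.map_congr rfl fun e _ => Prod.ext (key _) (key _)
  simp only [mu₂, mu, LGraph.contract, c1, c2, c3, c4, smul_smul, ← sgn_add]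
  rw [Multiset.cons_swap (i, j) (j, l), Multiset.erase_cons_head, Multiset.cons_swap (j, l) (i, j),
    Multiset.erase_cons_head, Multiset.map_cons, Multiset.map_cons, Prod.map_apply, Prod.map_apply,
    c1, c2, c3, c4, Multiset.erase_cons_head, Multiset.erase_cons_head, hE,
    Finset.erase_right_comm (a := l) (b := j)]
  simp only [Function.update_of_ne hij, Function.update_self, Function.update_idem,
    Function.update_of_ne hil.symm]
  have hgen : A.gen ⟨(S.erase j).erase l, (E.map (Prod.map (collapse j l) (collapse j l))).map
      (Prod.map (collapse i j) (collapse i j)),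
      Function.update (Function.update p j (p j + p l)) i (p i + (p j + p l)),
      Function.update (Function.update w j (w j * w l)) i (w i * (w j * w l))⟩ =
      A.gen ⟨(S.erase j).erase l, (E.map (Prod.map (collapse j l) (collapse j l))).map
      (Prod.map (collapse i j) (collapse i j)), Function.update p i (p i + p j + p l),
      Function.update w i (w i * w j * w l)⟩ := by
    rw [_root_.mul_assoc, add_assoc]
    refine A.gen_congr (fun x hx => ?_) (fun x hx => ?_) <;>
    · have := Finset.ne_of_mem_erase (Finset.mem_of_mem_erase hx)
      by_cases hxi : x = i <;> simp [hxi, this]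
  rw [hgen]
  refine smul_add_smul_eq_zero ?_
  have m2 : l ∈ S.erase j := Finset.mem_erase.2 ⟨hjl.symm, hl⟩
  have m3 : i ∈ S.erase j := Finset.mem_erase.2 ⟨hij, hi⟩
  have m4 : i ∈ S.erase l := Finset.mem_erase.2 ⟨hil, hi⟩
  have m5 : j ∈ S.erase l := Finset.mem_erase.2 ⟨hjl, hj⟩
  have m7 : l ∈ S.erase i := Finset.mem_erase.2 ⟨hil.symm, hl⟩
  simp only [contractExp, Function.update_of_ne hij, Function.update_self,
    Function.update_of_ne hil.symm, before_erase m2, before_erase m3, before_erase m4,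
    before_erase m5, before_update m3, before_update m5, before_erase hi, before_erase hj,
    before_erase hl, lt_self_iff_false, if_false]
  push_cast
  generalize (before S p i : ZMod 2) = bi
  generalize (before S p j : ZMod 2) = bj
  generalize (before S p l : ZMod 2) = bl
  rcases lt_or_gt_of_ne hij with h1 | h1 <;> rcases lt_or_gt_of_ne hil with h3 | h3 <;>
    rcases lt_or_gt_of_ne hjl with h5 | h5 <;>
    first
    | omega
    | (simp only [h1, h3, h5, h1.not_gt, h3.not_gt, h5.not_gt, if_true, if_false, Int.cast_zero,
         Int.cast_sub, Int.cast_add, Int.cast_one, Function.update_self]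
       generalize (p i : ZMod 2) = pi
       generalize (p j : ZMod 2) = pj
       generalize (p l : ZMod 2) = pl
       clear * -
       revert bi bj bl pi pj pl
       decide)

theorem CDGA.mu₂_source (A : CDGA W) {S : Finset ℕ} {E : Multiset (ℕ × ℕ)} {p : ℕ → ℤ}
    {w : ℕ → W} {i j l : ℕ} (hg : A.Valid ⟨S, (i, j) ::ₘ (i, l) ::ₘ E, p, w⟩) (hjl : j ≠ l) :
    A.mu₂ ⟨S, (i, j) ::ₘ (i, l) ::ₘ E, p, w⟩ (i, j) (i, l) +
      A.mu₂ ⟨S, (i, j) ::ₘ (i, l) ::ₘ E, p, w⟩ (i, l) (i, j) = 0 := by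
  have hij : i ≠ j := hg.1.ne (e := (i, j)) (by simp)
  have hil : i ≠ l := hg.1.ne (e := (i, l)) (by simp)
  obtain ⟨hi, hj⟩ : i ∈ S ∧ j ∈ S := hg.1.mem (i, j) (by simp)
  obtain ⟨-, hl⟩ : i ∈ S ∧ l ∈ S := hg.1.mem (i, l) (by simp)
  have c1 : collapse i j i = i := by simp [collapse]
  have c2 : collapse i j l = l := by simp [collapse, hjl.symm]
  have c3 : collapse i l i = i := by simp [collapse]
  have c4 : collapse i l j = j := by simp [collapse, hjl]
  have hE : (E.map (Prod.map (collapse i j) (collapse i j))).map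
      (Prod.map (collapse i l) (collapse i l)) = (E.map (Prod.map (collapse i l) (collapse i l))).map
      (Prod.map (collapse i j) (collapse i j)) := by
    rw [Multiset.map_map, Multiset.map_map]
    have key : ∀ x, collapse i l (collapse i j x) = collapse i j (collapse i l x) := by
      intro x
      simp only [collapse]
      split_ifs <;> simp_all
    exact Multiset.map_congr rfl fun e _ => Prod.ext (key _) (key _)
  simp only [mu₂, mu, LGraph.contract, c1, c2, c3, c4, smul_smul, ← sgn_add]
  rw [Multiset.cons_swap (i, j) (i, l), Multiset.erase_cons_head, Multiset.cons_swap (i, l) (i, j),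
    Multiset.erase_cons_head, Multiset.map_cons, Multiset.map_cons, Prod.map_apply, Prod.map_apply,
    c1, c2, c3, c4, Multiset.erase_cons_head, Multiset.erase_cons_head, hE,
    Finset.erase_right_comm (a := l) (b := j)]
  simp only [Function.update_self, Function.update_idem, Function.update_of_ne hij.symm,
    Function.update_of_ne hil.symm]
  have hwi : w i ∈ A.gr (p i) := hg.2 i hi
  have hwj : w j ∈ A.gr (p j) := hg.2 j hj
  have hwl : w l ∈ A.gr (p l) := hg.2 l hl
  have m2 : l ∈ S.erase j := Finset.mem_erase.2 ⟨hjl.symm, hl⟩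
  have m3 : i ∈ S.erase j := Finset.mem_erase.2 ⟨hij, hi⟩
  have m4 : i ∈ S.erase l := Finset.mem_erase.2 ⟨hil, hi⟩
  have m5 : j ∈ S.erase l := Finset.mem_erase.2 ⟨hjl, hj⟩
  have m6 : i ∈ (S.erase j).erase l := Finset.mem_erase.2 ⟨hil, m3⟩
  have hw : w i * w l * w j = sgn (p l * p j) • (w i * w j * w l) := by
    rw [_root_.mul_assoc, A.mul_comm hwl hwj, mul_smul_comm, ← _root_.mul_assoc]
  rw [hw, show p i + p l + p j = p i + p j + p l by ring,
    A.gen_smul (p := Function.update p i (p i + p j + p l)) _ m6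
    (by simpa using A.mul_mem (A.mul_mem hwi hwj) hwl), smul_smul, ← sgn_add]
  refine smul_add_smul_eq_zero ?_
  have m7 : l ∈ S.erase i := Finset.mem_erase.2 ⟨hil.symm, hl⟩
  have m8 : j ∈ S.erase i := Finset.mem_erase.2 ⟨hij.symm, hj⟩
  simp only [contractExp, Function.update_of_ne hij.symm, Function.update_self,
    Function.update_of_ne hil.symm, before_erase m2, before_erase m3, before_erase m4,
    before_erase m5, before_update m3, before_update m4, before_erase hi, before_erase hj,
    before_erase hl, lt_self_iff_false, if_false]
  push_cast
  generalize (before S p i : ZMod 2) = bi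
  generalize (before S p j : ZMod 2) = bj
  generalize (before S p l : ZMod 2) = bl
  rcases lt_or_gt_of_ne hij with h1 | h1 <;> rcases lt_or_gt_of_ne hil with h3 | h3 <;>
    rcases lt_or_gt_of_ne hjl with h5 | h5 <;>
    first
    | omega
    | (simp only [h1, h3, h5, h1.not_gt, h3.not_gt, h5.not_gt, if_true, if_false, Int.cast_zero,
         Int.cast_sub, Int.cast_add, Int.cast_one, Function.update_self]
       generalize (p i : ZMod 2) = pi
       generalize (p j : ZMod 2) = pj
       generalize (p l : ZMod 2) = pl
       clear * -
       revert bi bj bl pi pj pl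
       decide)

theorem CDGA.mu₂_target (A : CDGA W) {S : Finset ℕ} {E : Multiset (ℕ × ℕ)} {p : ℕ → ℤ}
    {w : ℕ → W} {i j l : ℕ} (hg : A.Valid ⟨S, (i, j) ::ₘ (l, j) ::ₘ E, p, w⟩) (hil : i ≠ l) :
    A.mu₂ ⟨S, (i, j) ::ₘ (l, j) ::ₘ E, p, w⟩ (i, j) (l, j) +
      A.mu₂ ⟨S, (i, j) ::ₘ (l, j) ::ₘ E, p, w⟩ (l, j) (i, j) = 0 := by
  have hij : i ≠ j := hg.1.ne (e := (i, j)) (by simp)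
  have hlj : l ≠ j := hg.1.ne (e := (l, j)) (by simp)
  obtain ⟨hi, hj⟩ : i ∈ S ∧ j ∈ S := hg.1.mem (i, j) (by simp)
  obtain ⟨hl, -⟩ : l ∈ S ∧ j ∈ S := hg.1.mem (l, j) (by simp)
  have c1 : collapse i j l = l := by simp [collapse, hlj]
  have c2 : collapse i j j = i := by simp [collapse]
  have c3 : collapse l j i = i := by simp [collapse, hij]
  have c4 : collapse l j j = l := by simp [collapse]
  have hE : (E.map (Prod.map (collapse i j) (collapse i j))).map
      (Prod.map (collapse i l) (collapse i l)) = (E.map (Prod.map (collapse l j) (collapse l j))).map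
      (Prod.map (collapse i l) (collapse i l)) := by
    rw [Multiset.map_map, Multiset.map_map]
    have key : ∀ x, collapse i l (collapse i j x) = collapse i l (collapse l j x) := by
      intro x
      simp only [collapse]
      split_ifs <;> simp_all
    exact Multiset.map_congr rfl fun e _ => Prod.ext (key _) (key _)
  have hv : A.Valid ⟨S.erase j, (l, i) ::ₘ E.map (Prod.map (collapse i j) (collapse i j)),
      Function.update p i (p i + p j), Function.update w i (w i * w j)⟩ := by
    have := hg.contract (i := i) (j := j) (by simp)
    simp only [LGraph.contract, Multiset.erase_cons_head, Multiset.map_cons, Prod.map_apply, c1,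
      c2] at this
    exact this
  simp only [mu₂, LGraph.contract, c1, c2, c3, c4]
  rw [Multiset.erase_cons_head, Multiset.map_cons, Prod.map_apply, c1, c2, A.mu_swap hv,
    Multiset.cons_swap (i, j) (l, j), Multiset.erase_cons_head, Multiset.map_cons,
    Prod.map_apply, c3, c4, smul_neg, ← neg_smul, neg_sgn]
  simp only [mu, LGraph.contract, Multiset.erase_cons_head, hE, smul_smul, ← sgn_add,
    Function.update_self, Function.update_idem, Function.update_of_ne hil.symm,
    Function.update_of_ne hil]
  have hwi : w i ∈ A.gr (p i) := hg.2 i hi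
  have hwj : w j ∈ A.gr (p j) := hg.2 j hj
  have hwl : w l ∈ A.gr (p l) := hg.2 l hl
  have m2 : l ∈ S.erase j := Finset.mem_erase.2 ⟨hlj, hl⟩
  have m3 : i ∈ S.erase j := Finset.mem_erase.2 ⟨hij, hi⟩
  have m6 : i ∈ (S.erase j).erase l := Finset.mem_erase.2 ⟨hil, m3⟩
  have hw : w i * (w l * w j) = sgn (p l * p j) • (w i * w j * w l) := by
    rw [A.mul_comm hwl hwj, mul_smul_comm, ← _root_.mul_assoc]
  have hgen : A.gen ⟨(S.erase j).erase l, (E.map (Prod.map (collapse l j) (collapse l j))).map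
      (Prod.map (collapse i l) (collapse i l)),
      Function.update (Function.update p l (p l + p j)) i (p i + (p l + p j)),
      Function.update (Function.update w l (w l * w j)) i (w i * (w l * w j))⟩ =
      sgn (p l * p j) • A.gen ⟨(S.erase j).erase l,
      (E.map (Prod.map (collapse l j) (collapse l j))).map
      (Prod.map (collapse i l) (collapse i l)), Function.update p i (p i + p j + p l),
      Function.update w i (w i * w j * w l)⟩ := by
    rw [← A.gen_smul (p := Function.update p i (p i + p j + p l)) _ m6
      (by simpa using A.mul_mem (A.mul_mem hwi hwj) hwl), ← hw,
      show p i + (p l + p j) = p i + p j + p l by ring]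
    refine A.gen_congr (fun x hx => ?_) (fun x hx => ?_) <;>
    · have := Finset.ne_of_mem_erase hx
      by_cases hxi : x = i <;> simp [hxi, this]
  rw [hgen, smul_smul, ← sgn_add]
  refine smul_add_smul_eq_zero ?_
  have m7 : l ∈ S.erase i := Finset.mem_erase.2 ⟨hil.symm, hl⟩
  have m8 : j ∈ S.erase i := Finset.mem_erase.2 ⟨hij.symm, hj⟩
  have m9 : j ∈ S.erase l := Finset.mem_erase.2 ⟨hlj.symm, hj⟩
  simp only [contractExp, Function.update_self, Function.update_of_ne hil.symm,
    Function.update_of_ne hil, before_erase m2, before_erase m3, before_update m3,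
    before_update m2, before_erase hi, before_erase hj, before_erase hl, lt_self_iff_false,
    if_false]
  push_cast
  generalize (before S p i : ZMod 2) = bi
  generalize (before S p j : ZMod 2) = bj
  generalize (before S p l : ZMod 2) = bl
  rcases lt_or_gt_of_ne hij with h1 | h1 <;> rcases lt_or_gt_of_ne hil with h3 | h3 <;>
    rcases lt_or_gt_of_ne hlj with h5 | h5 <;>
    first
    | omega
    | (simp only [h1, h3, h5, h1.not_gt, h3.not_gt, h5.not_gt, if_true, if_false, Int.cast_zero,
         Int.cast_sub, Int.cast_add, Int.cast_one, Function.update_self,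
         Function.update_of_ne hil.symm, Function.update_of_ne hil]
       generalize (p i : ZMod 2) = pi
       generalize (p j : ZMod 2) = pj
       generalize (p l : ZMod 2) = pl
       clear * -
       revert bi bj bl pi pj pl
       decide)

theorem CDGA.mu₂_antisymm (A : CDGA W) {S : Finset ℕ} {E : Multiset (ℕ × ℕ)} {p : ℕ → ℤ}
    {w : ℕ → W} {e f : ℕ × ℕ} (hg : A.Valid ⟨S, e ::ₘ f ::ₘ E, p, w⟩) :
    A.mu₂ ⟨S, e ::ₘ f ::ₘ E, p, w⟩ e f + A.mu₂ ⟨S, e ::ₘ f ::ₘ E, p, w⟩ f e = 0 := by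
  obtain ⟨i, j⟩ := e
  obtain ⟨k, l⟩ := f
  have hij : i ≠ j := hg.1.ne (e := (i, j)) (by simp)
  have hkl : k ≠ l := hg.1.ne (e := (k, l)) (by simp)
  have hc : collapse i j k ≠ collapse i j l := by
    have h1 := hg.contract (i := i) (j := j) (by simp)
    exact h1.1.ne (e := (collapse i j k, collapse i j l))
      (by simp [LGraph.contract, Multiset.erase_cons_head])
  by_cases hjk : j = k
  · subst hjk
    refine A.mu₂_chain hg fun h => hc ?_
    subst h
    simp [collapse]
  by_cases hli : l = i
  · subst hli
    rw [Multiset.cons_swap] at hg ⊢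
    rw [add_comm]
    exact A.mu₂_chain hg fun h => hc (by simp [collapse, h])
  by_cases hik : i = k
  · subst hik
    exact A.mu₂_source hg fun h => hc (by simp [collapse, h])
  by_cases hjl : j = l
  · subst hjl
    exact A.mu₂_target hg hik
  exact A.mu₂_disjoint hg hik (fun h => hli h.symm) hjk hjl

theorem CDGA.dMu_dMu (A : CDGA W) : A.dMu ∘ₗ A.dMu = 0 := by
  refine A.hom_ext fun g hg => ?_
  rw [LinearMap.comp_apply, A.dMu_gen hg, LinearMap.zero_apply, map_multiset_sum, Multiset.map_map]
  have h1 : (g.edges.map (A.dMu ∘ fun e => A.mu g e.1 e.2)) =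
      g.edges.map fun e => ((g.edges.erase e).map (A.mu₂ g e)).sum := by
    refine Multiset.map_congr rfl fun e he => ?_
    rw [Function.comp_apply, mu, map_smul, A.dMu_gen (hg.contract he), Multiset.smul_sum,
      Multiset.map_map]
    simp only [LGraph.contract, Multiset.map_map]
    rfl
  rw [h1]
  refine sum_erase_antisymm _ _ fun e he f hf => ?_
  obtain ⟨E, hE⟩ := Multiset.exists_cons_of_mem hf
  have hE' : g.edges = e ::ₘ f ::ₘ E := by rw [← hE, Multiset.cons_erase he]
  obtain ⟨S, E', p, w⟩ := g
  simp only at hE'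
  subst hE'
  exact A.mu₂_antisymm hg

/-- The total differential of the bicomplex `𝔼(W)`. -/
def CDGA.D (A : CDGA W) : A.LieCoalg →ₗ[ℚ] A.LieCoalg := A.dW + A.dMu

theorem CDGA.D_D (A : CDGA W) (x : A.LieCoalg) : A.D (A.D x) = 0 := by
  have h1 := LinearMap.congr_fun A.dW_dW x
  have h2 := LinearMap.congr_fun A.dMu_dMu x
  have h3 := LinearMap.congr_fun A.dW_dMu x
  simp only [LinearMap.comp_apply, LinearMap.add_apply, LinearMap.zero_apply] at h1 h2 h3
  simp only [D, LinearMap.add_apply, map_add]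
  rw [h1, h2, zero_add, add_zero, add_comm, h3]

/-! ### The spectral sequence -/

/-- The total degree `p + q` of a labelled graph in column `p = 1 - n`, where `n` is the number of
vertices, and row `q`, the sum of the degrees of the labels. -/
def LGraph.totalDeg (g : LGraph W) : ℤ := ∑ k ∈ g.verts, g.deg k + (1 - g.verts.card)

/-- The filtration of `𝔼(W)` by columns, in total degree `m`: the subspace spanned by the graphs of
total degree `m` in the columns `≥ p`, that is, with at most `1 - p` vertices. -/
def CDGA.fil (A : CDGA W) (p m : ℤ) : Submodule ℚ A.LieCoalg :=
  Submodule.span ℚ {x | ∃ g, A.Valid g ∧ (g.verts.card : ℤ) ≤ 1 - p ∧ g.totalDeg = m ∧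
    A.gen g = x}

theorem CDGA.gen_mem_fil (A : CDGA W) {g : LGraph W} {p m : ℤ} (hg : A.Valid g)
    (hp : (g.verts.card : ℤ) ≤ 1 - p) (hm : g.totalDeg = m) : A.gen g ∈ A.fil p m :=
  Submodule.subset_span ⟨g, hg, hp, hm, rfl⟩

theorem CDGA.dW_mem_fil (A : CDGA W) {p m : ℤ} {x : A.LieCoalg} (hx : x ∈ A.fil p m) :
    A.dW x ∈ A.fil p (m + 1) := by
  refine (Submodule.span_le (p := (A.fil p (m + 1)).comap A.dW)).2 ?_ hx
  rintro _ ⟨g, hg, hp, hm, rfl⟩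
  obtain ⟨S, E, n, w⟩ := g
  change A.dW _ ∈ A.fil p (m + 1)
  rw [A.dW_gen hg]
  refine Submodule.sum_mem _ fun k hk => Submodule.smul_mem _ _ (A.gen_mem_fil
    (hg.update (A.d_mem (hg.2 k hk))) hp ?_)
  simp only [LGraph.totalDeg] at hm ⊢
  rw [Finset.sum_update_of_mem hk, ← hm, ← Finset.add_sum_erase S _ hk,
    Finset.sdiff_singleton_eq_erase]
  ring

theorem CDGA.dMu_mem_fil (A : CDGA W) {p m : ℤ} {x : A.LieCoalg} (hx : x ∈ A.fil p m) :
    A.dMu x ∈ A.fil (p + 1) (m + 1) := by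
  refine (Submodule.span_le (p := (A.fil (p + 1) (m + 1)).comap A.dMu)).2 ?_ hx
  rintro _ ⟨g, hg, hp, hm, rfl⟩
  change A.dMu _ ∈ A.fil (p + 1) (m + 1)
  rw [A.dMu_gen hg]
  refine multiset_sum_mem _ fun y hy => ?_
  obtain ⟨e, he, rfl⟩ := Multiset.mem_map.1 hy
  obtain ⟨i, j⟩ := e
  obtain ⟨hi, hj⟩ := hg.1.mem _ he
  have hij : i ≠ j := hg.1.ne he
  have hi' : i ∈ g.verts.erase j := Finset.mem_erase.2 ⟨hij, hi⟩
  have hc : ((g.verts.erase j).card : ℤ) = g.verts.card - 1 := by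
    rw [← Finset.card_erase_add_one hj]; push_cast; ring
  refine Submodule.smul_mem _ _ (A.gen_mem_fil (hg.contract he) ?_ ?_)
  · simp only [LGraph.contract, hc]; linarith
  · simp only [LGraph.totalDeg, LGraph.contract, hc] at hm ⊢
    rw [Finset.sum_update_of_mem hi', ← hm, ← Finset.add_sum_erase g.verts _ hj,
      ← Finset.add_sum_erase (g.verts.erase j) _ hi', Finset.sdiff_singleton_eq_erase]
    ring

theorem CDGA.fil_mono (A : CDGA W) {p p' m : ℤ} (h : p' ≤ p) : A.fil p m ≤ A.fil p' m := by
  refine Submodule.span_mono ?_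
  rintro _ ⟨g, hg, hp, hm, rfl⟩
  exact ⟨g, hg, by linarith, hm, rfl⟩

/-- The total differential respects the filtration. -/
theorem CDGA.D_mem_fil (A : CDGA W) {p m : ℤ} {x : A.LieCoalg} (hx : x ∈ A.fil p m) :
    A.D x ∈ A.fil p (m + 1) :=
  add_mem (A.dW_mem_fil hx) (A.fil_mono (by linarith) (A.dMu_mem_fil hx))

/-- `Z_r^{p,q}`: the elements of filtration `p` and total degree `p + q` whose differential has
filtration `p + r`. -/
def CDGA.Z (A : CDGA W) (r p q : ℤ) : Submodule ℚ A.LieCoalg :=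
  A.fil p (p + q) ⊓ (A.fil (p + r) (p + q + 1)).comap A.D

/-- `B_r^{p,q} = Z_{r-1}^{p+1,q-1} + D Z_{r-1}^{p-r+1,q+r-2}`. -/
def CDGA.B (A : CDGA W) (r p q : ℤ) : Submodule ℚ A.LieCoalg :=
  A.Z (r - 1) (p + 1) (q - 1) ⊔ (A.Z (r - 1) (p - r + 1) (q + r - 2)).map A.D

/-- The entry `E_r^{p,q} = Z_r^{p,q} / B_r^{p,q}` of the `r`-th page (`0 ≤ r`) of the Sinha–Walter
spectral sequence, the spectral sequence of the filtration of `𝔼(W)` by columns. -/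
abbrev CDGA.Page (A : CDGA W) (r p q : ℤ) : Type _ :=
  A.Z r p q ⧸ (A.B r p q).submoduleOf (A.Z r p q)

/-- The class of an element of `Z_r^{p,q}` in `E_r^{p,q}`. -/
def CDGA.pageMk (A : CDGA W) (r p q : ℤ) : A.Z r p q →ₗ[ℚ] A.Page r p q :=
  ((A.B r p q).submoduleOf (A.Z r p q)).mkQ

theorem CDGA.D_mem_Z (A : CDGA W) {r p q p' q' : ℤ} (hp : p' = p + r) (hq : q' = q - r + 1)
    {x : A.LieCoalg} (hx : x ∈ A.Z r p q) : A.D x ∈ A.Z r p' q' := by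
  refine ⟨?_, ?_⟩
  · rw [hp, hq, show p + r + (q - r + 1) = p + q + 1 by ring]
    exact hx.2
  · change A.D (A.D x) ∈ A.fil (p' + r) (p' + q' + 1)
    rw [A.D_D]
    exact zero_mem _

theorem CDGA.D_mem_B (A : CDGA W) {r p q p' q' : ℤ} (hp : p' = p + r) (hq : q' = q - r + 1)
    {x : A.LieCoalg} (hx : x ∈ A.B r p q) : A.D x ∈ A.B r p' q' := by
  obtain ⟨y, hy, _, ⟨z, -, rfl⟩, rfl⟩ := Submodule.mem_sup.1 hx
  rw [map_add, A.D_D, add_zero]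
  refine Submodule.mem_sup_right ⟨y, ?_, rfl⟩
  rw [hp, hq, show p + r - r + 1 = p + 1 by ring, show q - r + 1 + r - 2 = q - 1 by ring]
  exact hy

/-- The differential `d_r : E_r^{p,q} → E_r^{p+r,q-r+1}`. -/
def CDGA.pageD (A : CDGA W) (r p q p' q' : ℤ) (hp : p' = p + r) (hq : q' = q - r + 1) :
    A.Page r p q →ₗ[ℚ] A.Page r p' q' :=
  Submodule.mapQ _ _ (A.D.restrict fun _ hx => A.D_mem_Z hp hq hx) fun _ hx => A.D_mem_B hp hq hx

/-- The class `x ∈ E_1^{p,q}` survives to the `s`-th page, where it gives the class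
`y ∈ E_s^{p,q}`: both are represented by one element of `Z_s^{p,q}`. -/
def CDGA.SurvivesTo (A : CDGA W) (s : ℤ) {p q : ℤ} (x : A.Page 1 p q) (y : A.Page s p q) : Prop :=
  ∃ (z : A.LieCoalg) (h₁ : z ∈ A.Z 1 p q) (h : z ∈ A.Z s p q),
    A.pageMk 1 p q ⟨z, h₁⟩ = x ∧ A.pageMk s p q ⟨z, h⟩ = y

/-! ### Cohomology and Massey products -/

/-- The cocycles of degree `q`. -/
def CDGA.cocycles (A : CDGA W) (q : ℤ) : Submodule ℚ W := A.gr q ⊓ LinearMap.ker A.d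

/-- The coboundaries of degree `q`. -/
def CDGA.coboundaries (A : CDGA W) (q : ℤ) : Submodule ℚ W := (A.gr (q - 1)).map A.d

/-- The cohomology `H^q(W)`. -/
abbrev CDGA.H (A : CDGA W) (q : ℤ) : Type _ :=
  A.cocycles q ⧸ (A.coboundaries q).submoduleOf (A.cocycles q)

/-- The cohomology class of a cocycle. -/
def CDGA.classH (A : CDGA W) (q : ℤ) : A.cocycles q →ₗ[ℚ] A.H q :=
  ((A.coboundaries q).submoduleOf (A.cocycles q)).mkQ

/-- The degree of the entry `(i, j)` of a defining system: `n_i + ⋯ + n_j - (j - i)`. -/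
def masseyDeg (n : ℕ → ℤ) (i j : ℕ) : ℤ := ∑ k ∈ Finset.Icc i j, n k - ((j : ℤ) - i)

/-- The sum `∑_{i ≤ k < j} \bar M_{i,k} M_{k+1,j}`, where `\bar x = (-1)^{|x|+1} x`. -/
def masseySum (n : ℕ → ℤ) (M : ℕ → ℕ → W) (i j : ℕ) : W :=
  ∑ k ∈ Finset.Ico i j, sgn (masseyDeg n i k + 1) • (M i k * M (k + 1) j)

/-- `M` is a defining system for the `r`-th order Massey product of the cohomology classes of
the cocycles `a 0, …, a (r - 1)` of degrees `n 0, …, n (r - 1)`. Only the entries `M i j` with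
`i ≤ j < r` and `(i, j) ≠ (0, r - 1)` matter. -/
structure CDGA.IsDefiningSystem (A : CDGA W) (r : ℕ) (n : ℕ → ℤ) (a : ℕ → W) (M : ℕ → ℕ → W) :
    Prop where
  diag_mem : ∀ i < r, M i i ∈ A.cocycles (n i)
  diag_class : ∀ i < r, M i i - a i ∈ A.coboundaries (n i)
  mem : ∀ i j, i < j → j < r → ¬ (i = 0 ∧ j + 1 = r) → M i j ∈ A.gr (masseyDeg n i j)
  d_eq : ∀ i j, i < j → j < r → ¬ (i = 0 ∧ j + 1 = r) → A.d (M i j) = masseySum n M i j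

/-- The Massey product `⟨[a 0], …, [a (r - 1)]⟩` is defined. -/
def CDGA.MasseyDefined (A : CDGA W) (r : ℕ) (n : ℕ → ℤ) (a : ℕ → W) : Prop :=
  ∃ M, A.IsDefiningSystem r n a M

/-- The `r`-th order Massey product `⟨[a 0], …, [a (r - 1)]⟩`, the set of the cohomology classes
that all the defining systems give. -/
def CDGA.massey (A : CDGA W) (r : ℕ) (n : ℕ → ℤ) (a : ℕ → W) :
    Set (A.H (∑ k ∈ Finset.range r, n k - r + 2)) :=
  {c | ∃ M, A.IsDefiningSystem r n a M ∧
    ∃ h : masseySum n M 0 (r - 1) ∈ A.cocycles (∑ k ∈ Finset.range r, n k - r + 2),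
      A.classH _ ⟨masseySum n M 0 (r - 1), h⟩ = c}

/-! ### The classes `a_1 | a_2 | ⋯ | a_r` -/

/-- The long graph `0 → 1 → ⋯ → r - 1` with the labels `a 0, …, a (r - 1)` of degrees
`n 0, …, n (r - 1)`. -/
def longGraph (r : ℕ) (n : ℕ → ℤ) (a : ℕ → W) : LGraph W where
  verts := Finset.range r
  edges := (Multiset.range (r - 1)).map fun i => (i, i + 1)
  deg := n
  lab := a

/-- The element `a 0 | a 1 | ⋯ | a (r - 1)` of `𝔼(W)`. -/
def CDGA.bar (A : CDGA W) (r : ℕ) (n : ℕ → ℤ) (a : ℕ → W) : A.LieCoalg := A.gen (longGraph r n a)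

theorem CDGA.valid_longGraph (A : CDGA W) {r : ℕ} (hr : 1 ≤ r) {n : ℕ → ℤ} {a : ℕ → W}
    (ha : ∀ i < r, a i ∈ A.gr (n i)) : A.Valid (longGraph r n a) := by
  refine ⟨⟨?_, ?_, ?_⟩, fun k hk => ha k (Finset.mem_range.1 hk)⟩
  · intro e he
    obtain ⟨i, hi, rfl⟩ := Multiset.mem_map.1
      (show e ∈ (Multiset.range (r - 1)).map fun i => (i, i + 1) from he)
    have := Multiset.mem_range.1 hi
    simp only [longGraph, Finset.mem_range]
    omega
  · have key : ∀ x < r, Relation.EqvGen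
        (fun x y : ℕ => (x, y) ∈ (longGraph r n a).edges) 0 x := by
      intro x
      induction x with
      | zero => intro _; exact .refl _
      | succ x ih =>
        intro hx
        exact .trans _ _ _ (ih (by omega)) (.rel _ _ (Multiset.mem_map.2
          ⟨x, Multiset.mem_range.2 (by omega), rfl⟩))
    exact fun x hx y hy => .trans _ _ _ (.symm _ _ (key x (Finset.mem_range.1 hx)))
      (key y (Finset.mem_range.1 hy))
  · simp only [longGraph, Finset.card_range, Multiset.card_map, Multiset.card_range]
    omega

theorem CDGA.bar_mem_fil (A : CDGA W) {r : ℕ} (hr : 1 ≤ r) {n : ℕ → ℤ} {a : ℕ → W}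
    (ha : ∀ i < r, a i ∈ A.gr (n i)) :
    A.bar r n a ∈ A.fil (1 - r) (1 - r + ∑ k ∈ Finset.range r, n k) :=
  A.gen_mem_fil (A.valid_longGraph hr ha) (by simp [longGraph])
    (by simp [longGraph, LGraph.totalDeg]; ring)

theorem CDGA.dW_bar (A : CDGA W) {r : ℕ} (hr : 1 ≤ r) {n : ℕ → ℤ} {a : ℕ → W}
    (ha : ∀ i < r, a i ∈ A.cocycles (n i)) : A.dW (A.bar r n a) = 0 := by
  rw [bar, A.dW_gen (A.valid_longGraph hr fun i hi => (ha i hi).1)]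
  refine Finset.sum_eq_zero fun k hk => ?_
  have h : A.d (a k) = 0 := (ha k (Finset.mem_range.1 hk)).2
  have h0 : A.gen ⟨Finset.range r, (Multiset.range (r - 1)).map fun i => (i, i + 1),
      Function.update n k (n k + 1), Function.update a k 0⟩ = 0 := A.gen_zero hk
  simp only [dAt, longGraph, h, h0, smul_zero]

theorem CDGA.bar_mem_Z_one (A : CDGA W) {r : ℕ} (hr : 1 ≤ r) {n : ℕ → ℤ} {a : ℕ → W}
    (ha : ∀ i < r, a i ∈ A.cocycles (n i)) :
    A.bar r n a ∈ A.Z 1 (1 - r) (∑ k ∈ Finset.range r, n k) := by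
  have h := A.bar_mem_fil hr fun i hi => (ha i hi).1
  refine ⟨h, ?_⟩
  rw [SetLike.mem_coe, Submodule.mem_comap, D, LinearMap.add_apply, A.dW_bar hr ha, zero_add]
  exact A.dMu_mem_fil h

/-- The class `[a 0 | a 1 | ⋯ | a (r - 1)]` in `E_1^{1-r,q}`, where `a i` is a cocycle of
degree `n i` and `q = n 0 + ⋯ + n (r - 1)`. -/
def CDGA.barClass (A : CDGA W) {r : ℕ} (hr : 1 ≤ r) {n : ℕ → ℤ} {a : ℕ → W}
    (ha : ∀ i < r, a i ∈ A.cocycles (n i)) : A.Page 1 (1 - r) (∑ k ∈ Finset.range r, n k) :=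
  A.pageMk 1 _ _ ⟨A.bar r n a, A.bar_mem_Z_one hr ha⟩

/-- The inclusion of `W` in degree `q` as the graphs with one vertex. -/
def CDGA.vertex (A : CDGA W) (q : ℤ) : A.gr q →ₗ[ℚ] A.LieCoalg where
  toFun x := A.bar 1 (fun _ => q) (fun _ => (x : W))
  map_add' x y := by
    have h : ∀ x : W, A.bar 1 (fun _ => q) (fun _ => x) =
        A.gen ⟨Finset.range 1, 0, fun _ => q, Function.update (fun _ => 0) 0 x⟩ := fun x =>
      A.gen_congr (fun _ _ => rfl) fun k hk => by simp at hk; simp [hk]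
    rw [h, h, h, Submodule.coe_add, A.gen_add (by simp) x.2 y.2]
  map_smul' c x := by
    have h : ∀ x : W, A.bar 1 (fun _ => q) (fun _ => x) =
        A.gen ⟨Finset.range 1, 0, fun _ => q, Function.update (fun _ => 0) 0 x⟩ := fun x =>
      A.gen_congr (fun _ _ => rfl) fun k hk => by simp at hk; simp [hk]
    rw [h, h, Submodule.coe_smul, A.gen_smul c (by simp) x.2]
    rfl

theorem CDGA.D_vertex (A : CDGA W) (q : ℤ) (x : A.gr q) :
    A.D (A.vertex q x) = A.vertex (q + 1) ⟨A.d x, A.d_mem x.2⟩ := by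
  have hv := A.valid_longGraph (r := 1) le_rfl (n := fun _ => q) (a := fun _ => (x : W))
    (fun _ _ => x.2)
  change A.D (A.gen (longGraph 1 (fun _ => q) fun _ => (x : W))) = _
  rw [D, LinearMap.add_apply, A.dW_gen hv, A.dMu_gen hv]
  have h0 : (longGraph 1 (fun _ => q) fun _ => (x : W)).verts = {0} := by simp [longGraph]
  have h1 : (longGraph 1 (fun _ => q) fun _ => (x : W)).edges = 0 := by simp [longGraph]
  rw [h0, h1, Finset.sum_singleton, Multiset.map_zero, Multiset.sum_zero, add_zero, dAt]
  have h2 : before (longGraph 1 (fun _ => q) fun _ => (x : W)).verts (fun _ => q) 0 = 0 := by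
    simp [before]
  change sgn (before (longGraph 1 (fun _ => q) fun _ => (x : W)).verts (fun _ => q) 0) • _ = _
  rw [h2, sgn_zero, one_smul]
  exact A.gen_congr (fun k hk => by simp [longGraph] at hk; simp [hk, longGraph])
    fun k hk => by simp [longGraph] at hk; simp [hk, longGraph]

theorem CDGA.vertex_mem_Z (A : CDGA W) {s q : ℤ} (x : A.cocycles q) :
    A.vertex q ⟨x, x.2.1⟩ ∈ A.Z s 0 q := by
  refine ⟨?_, ?_⟩
  · have := A.bar_mem_fil (r := 1) le_rfl (n := fun _ => q) (a := fun _ => (x : W))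
      (fun _ _ => x.2.1)
    rw [Finset.sum_range_one, Nat.cast_one, sub_self] at this
    exact this
  · have h : A.d (x : W) = 0 := x.2.2
    rw [SetLike.mem_coe, Submodule.mem_comap, A.D_vertex]
    simp only [h]
    have : A.vertex (q + 1) (⟨0, by simp⟩ : A.gr (q + 1)) = 0 := map_zero _
    rw [this]
    exact zero_mem _

/-- The map `H^q(W) → E_s^{0,q}` (`1 ≤ s`) that sends the class of a cocycle `x` to the class of the
graph with one vertex, labelled `x`. -/
def CDGA.toPage (A : CDGA W) (s q : ℤ) (hs : 1 ≤ s) : A.H q →ₗ[ℚ] A.Page s 0 q :=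
  Submodule.mapQ _ _
    { toFun := fun x : A.cocycles q => ⟨A.vertex q ⟨x, x.2.1⟩, A.vertex_mem_Z x⟩
      map_add' := fun x y => Subtype.ext ((A.vertex q).map_add ⟨x, x.2.1⟩ ⟨y, y.2.1⟩)
      map_smul' := fun c x => Subtype.ext ((A.vertex q).map_smul c ⟨x, x.2.1⟩) } (by
    rintro ⟨x, hx⟩ ⟨v, hv, hvx⟩
    have hf : A.vertex (q - 1) ⟨v, hv⟩ ∈ A.fil 0 (q - 1) := by
      have := A.bar_mem_fil (r := 1) le_rfl (n := fun _ => q - 1) (a := fun _ => v)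
        (fun _ _ => hv)
      rw [Finset.sum_range_one, Nat.cast_one, sub_self, zero_add] at this
      exact this
    refine Submodule.mem_sup_right ⟨A.vertex (q - 1) ⟨v, hv⟩, ⟨?_, ?_⟩, ?_⟩
    · rw [show 0 - s + 1 + (q + s - 2) = q - 1 by ring]
      exact A.fil_mono (by linarith) hf
    · rw [SetLike.mem_coe, Submodule.mem_comap, show 0 - s + 1 + (s - 1) = 0 by ring,
        show 0 - s + 1 + (q + s - 2) + 1 = q - 1 + 1 by ring]
      exact A.D_mem_fil hf
    · rw [A.D_vertex]
      change A.bar 1 (fun _ => q - 1 + 1) (fun _ => A.d v) = A.bar 1 (fun _ => q) fun _ => x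
      rw [sub_add_cancel]
      have : A.d v = x := hvx
      rw [this])

end

/-!
A defining system `M` is a solution of the Maurer–Cartan type equation
`d M_{ij} = ∑ \bar M_{ik} M_{k+1,j}` that lacks only its corner entry `(0, r - 1)`. Cut the interval
`[0, r)` into at least two consecutive blocks, put the label `M_{ij}` on the block `[i, j]`, and
join the blocks by arrows to a long graph. The sum `CDGA.cutSum` of these graphs, over all the
ways to cut, represents `[a 0 | ⋯ | a (r - 1)]` far down the spectral sequence:

* `d_W` splits one block into two factors of a product (`dW_blockGraph`, by the equations of the
  defining system), and `d_μ` merges two adjacent blocks into such a product (`dMu_blockGraph`).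
  Because the desuspended degree of `M_{ij}` is the sum of those of the entries that it spans, all
  the summands can be taken with the coefficient `1`: the Koszul signs then make each splitting
  cancel the corresponding merging. Only the mergings of two blocks into the single block
  `[0, r)` remain, since that block has no entry to be split, and so `D` of the sum is minus the
  one-vertex graph with the Massey sum as its label (`D_cutSum`).
* The only summand with `r` vertices is the cutting into singletons, with the labels `M_{ii}`
  (`cutSum_sub_bar_mem_B_one`), and these may be replaced by the cohomologous labels `a i`
  (`CDGA.bar_sub_bar_mem_B_one`).

Hence the class on the first page survives to page `r - 1`, with `d_{r-1}` equal to `-[m]` there. As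
a class on the first page gives only one class on a later page (`CDGA.SurvivesTo.unique`), a single
representative is enough.

A set of cuts is encoded as a subset `C` of `{1, …, r - 1}`, and the vertices of the block graph are
the starts of the blocks, `0` and the elements of `C`. Contracting the arrow into the vertex `c` then
removes `c` from `C`, and no relabelling is needed.
-/

noncomputable section

open Finset Finsupp

set_option linter.unusedSectionVars false

variable {W : Type*} [NonUnitalRing W] [Module ℚ W] [IsScalarTower ℚ W W] [SMulCommClass ℚ W W]

/-! ### Comparison of the first page with the later pages -/

theorem CDGA.mem_B_one_of_mem_fil (A : CDGA W) {p q : ℤ} {x : A.LieCoalg}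
    (hx : x ∈ A.fil (p + 1) (p + q)) : x ∈ A.B 1 p q := by
  refine Submodule.mem_sup_left ⟨?_, ?_⟩
  · rwa [show p + 1 + (q - 1) = p + q by ring]
  · have := A.D_mem_fil hx
    rwa [SetLike.mem_coe, Submodule.mem_comap, show p + 1 + (1 - 1) = p + 1 by ring,
      show p + 1 + (q - 1) + 1 = p + q + 1 by ring]

theorem CDGA.D_mem_B_one_of_mem_fil (A : CDGA W) {p q : ℤ} {v : A.LieCoalg}
    (hv : v ∈ A.fil p (p + q - 1)) : A.D v ∈ A.B 1 p q := by
  refine Submodule.mem_sup_right ⟨v, ⟨?_, ?_⟩, rfl⟩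
  · rwa [show p - 1 + 1 + (q + 1 - 2) = p + q - 1 by ring, sub_add_cancel]
  · have := A.D_mem_fil hv
    rwa [SetLike.mem_coe, Submodule.mem_comap, show p - 1 + 1 + (1 - 1) = p by ring,
      show p - 1 + 1 + (q + 1 - 2) + 1 = p + q - 1 + 1 by ring]

theorem CDGA.pageMk_eq_iff (A : CDGA W) {s p q : ℤ} (z z' : A.Z s p q) :
    A.pageMk s p q z = A.pageMk s p q z' ↔ (z : A.LieCoalg) - z' ∈ A.B s p q :=
  Submodule.Quotient.eq _

/-- Write `x = u + D v` as an element of `B 1`. Since `D u = D x` has filtration `p + s` and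
`D v = x - u` has filtration `p`, the same decomposition shows that `x` lies in `B s`. -/
theorem CDGA.mem_B_of_mem_B_one (A : CDGA W) {s p q : ℤ} (hs : 1 ≤ s) {x : A.LieCoalg}
    (hx : x ∈ A.Z s p q) (h : x ∈ A.B 1 p q) : x ∈ A.B s p q := by
  obtain ⟨u, hu, _, ⟨v, hv, rfl⟩, rfl⟩ := Submodule.mem_sup.1 h
  have hu' := hu.1
  rw [SetLike.mem_coe, show p + 1 + (q - 1) = p + q by ring] at hu'
  have hv' := hv.1
  rw [SetLike.mem_coe, show p - 1 + 1 + (q + 1 - 2) = p + q - 1 by ring, sub_add_cancel] at hv'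
  refine Submodule.add_mem_sup ⟨?_, ?_⟩ ⟨v, ⟨?_, ?_⟩, rfl⟩
  · rwa [SetLike.mem_coe, show p + 1 + (q - 1) = p + q by ring]
  · have := hx.2
    rw [SetLike.mem_coe, Submodule.mem_comap, map_add, A.D_D, add_zero] at this
    rwa [SetLike.mem_coe, Submodule.mem_comap, show p + 1 + (s - 1) = p + s by ring,
      show p + 1 + (q - 1) + 1 = p + q + 1 by ring]
  · rw [SetLike.mem_coe, show p - s + 1 + (q + s - 2) = p + q - 1 by ring]
    exact A.fil_mono (by linarith) hv'
  · rw [SetLike.mem_coe, Submodule.mem_comap, show p - s + 1 + (s - 1) = p by ring,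
      show p - s + 1 + (q + s - 2) + 1 = p + q by ring]
    exact (Submodule.add_mem_iff_right _ (A.fil_mono (by linarith) hu')).1 hx.1

/-- A class on the first page gives at most one class on page `s`. -/
theorem CDGA.SurvivesTo.unique (A : CDGA W) {s p q : ℤ} (hs : 1 ≤ s) {x : A.Page 1 p q}
    {y y' : A.Page s p q} (hy : A.SurvivesTo s x y) (hy' : A.SurvivesTo s x y') : y = y' := by
  obtain ⟨z, h₁, h, hx, rfl⟩ := hy
  obtain ⟨z', h₁', h', hx', rfl⟩ := hy'
  have := (A.pageMk_eq_iff _ _).1 (hx.trans hx'.symm)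
  exact (A.pageMk_eq_iff _ _).2 (A.mem_B_of_mem_B_one hs (sub_mem h h') this)

/-! ### Changing the labels within their cohomology classes -/

/-- Up to sign and up to `d_μ`, which raises the filtration, replacing the cocycle at `m` by the
coboundary `d v` gives the differential of the graph with the label `v` at `m`. -/
theorem CDGA.bar_update_d_mem_B_one (A : CDGA W) {r : ℕ} (hr : 1 ≤ r) {n : ℕ → ℤ} {b : ℕ → W}
    {m : ℕ} (hm : m < r) (hb : ∀ i < r, b i ∈ A.cocycles (n i)) {v : W}
    (hv : v ∈ A.gr (n m - 1)) :
    A.bar r n (Function.update b m (A.d v)) ∈ A.B 1 (1 - r) (∑ k ∈ Finset.range r, n k) := by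
  have hm' : m ∈ Finset.range r := Finset.mem_range.2 hm
  have hva : A.Valid (longGraph r (Function.update n m (n m - 1)) (Function.update b m v)) :=
    (A.valid_longGraph hr fun i hi => (hb i hi).1).update hv
  have hfil : A.gen (longGraph r (Function.update n m (n m - 1)) (Function.update b m v)) ∈
      A.fil (1 - r) (1 - r + ∑ k ∈ Finset.range r, n k - 1) := by
    refine A.gen_mem_fil hva (by simp [longGraph]) ?_
    simp only [LGraph.totalDeg, longGraph, Finset.card_range]
    rw [Finset.sum_update_of_mem hm', ← Finset.add_sum_erase _ n hm',
      Finset.sdiff_singleton_eq_erase]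
    ring
  have hdW : A.dW (A.gen (longGraph r (Function.update n m (n m - 1)) (Function.update b m v))) =
      sgn (before (Finset.range r) (Function.update n m (n m - 1)) m) •
        A.bar r n (Function.update b m (A.d v)) := by
    rw [A.dW_gen hva]
    change ∑ k ∈ Finset.range r, _ = _
    rw [Finset.sum_eq_single_of_mem m hm']
    · simp only [dAt, longGraph, bar, Function.update_self, Function.update_idem, sub_add_cancel,
        Function.update_eq_self]
    · intro k hk hkm
      have hd : A.d (b k) = 0 := (hb k (Finset.mem_range.1 hk)).2
      simp only [dAt, longGraph, Function.update_of_ne hkm, hd]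
      rw [A.gen_zero hk, smul_zero]
  have h1 := A.D_mem_B_one_of_mem_fil hfil
  have h2 := A.mem_B_one_of_mem_fil (p := 1 - r) (q := ∑ k ∈ Finset.range r, n k) (x := A.dMu _)
    (by simpa using A.dMu_mem_fil hfil)
  have h3 := sub_mem h1 h2
  rw [D, LinearMap.add_apply, add_sub_cancel_right, hdW] at h3
  have h4 := Submodule.smul_mem _
    (sgn (before (Finset.range r) (Function.update n m (n m - 1)) m)) h3
  rwa [smul_smul, sgn_mul_self, one_smul] at h4

theorem CDGA.bar_sub_bar_mem_B_one (A : CDGA W) {r : ℕ} (hr : 1 ≤ r) {n : ℕ → ℤ} {a b : ℕ → W}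
    (ha : ∀ i < r, a i ∈ A.cocycles (n i)) (hb : ∀ i < r, b i ∈ A.cocycles (n i))
    (hab : ∀ i < r, b i - a i ∈ A.coboundaries (n i)) :
    A.bar r n b - A.bar r n a ∈ A.B 1 (1 - r) (∑ k ∈ Finset.range r, n k) := by
  -- `c m` has the labels `b i` for `i < m` and `a i` for `i ≥ m`
  let c : ℕ → ℕ → W := fun m i => if i < m then b i else a i
  have key : ∀ m ≤ r, A.bar r n (c m) - A.bar r n a ∈
      A.B 1 (1 - r) (∑ k ∈ Finset.range r, n k) := by
    intro m
    induction m with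
    | zero => intro _; simp [c]
    | succ m ih =>
      intro hm
      obtain ⟨v, hv, hvd⟩ := hab m (by omega)
      have hc : ∀ i < r, c m i ∈ A.cocycles (n i) := fun i hi => by
        by_cases h : i < m
        · simpa [c, h] using hb i hi
        · simpa [c, h] using ha i hi
      have h1 : c (m + 1) = Function.update (c m) m (c m m + A.d v) := by
        funext i
        rcases lt_trichotomy i m with h | h | h
        · simp [c, h, h.ne, show i < m + 1 by omega]
        · subst h; simp [c, hvd]
        · simp [c, h.ne', h.not_gt, show ¬ i < m + 1 by omega]
      have hd : A.d v ∈ A.gr (n m) := by simpa using A.d_mem hv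
      have h2 : A.bar r n (c (m + 1)) = A.bar r n (c m) +
          A.bar r n (Function.update (c m) m (A.d v)) := by
        rw [h1, bar, longGraph, A.gen_add (Finset.mem_range.2 (by omega)) (hc m (by omega)).1 hd,
          Function.update_eq_self]
        rfl
      rw [h2, add_sub_right_comm]
      exact add_mem (ih (by omega)) (A.bar_update_d_mem_B_one hr (by omega) hc hv)
  have h := key r le_rfl
  have h2 : A.bar r n (c r) = A.bar r n b := A.gen_congr (fun _ _ => rfl) fun k hk => by
    simp [c, Finset.mem_range.1 hk]
  rwa [h2] at h

/-! ### The Massey sum is a cocycle -/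

theorem masseyDeg_add (n : ℕ → ℤ) {i c e : ℕ} (hic : i < c) (hce : c < e) :
    masseyDeg n i (c - 1) + masseyDeg n c (e - 1) = masseyDeg n i (e - 1) + 1 := by
  have h : ∀ x y : ℕ, x < y → ∑ k ∈ Finset.Icc x (y - 1), n k = ∑ k ∈ Finset.Ico x y, n k := by
    intro x y hxy
    congr 1
    ext k; simp only [Finset.mem_Icc, Finset.mem_Ico]; omega
  simp only [masseyDeg]
  rw [h i c hic, h c e hce, h i e (hic.trans hce), ← Finset.sum_Ico_consecutive n hic.le hce.le,
    Nat.cast_sub (by omega), Nat.cast_sub (by omega)]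
  ring

theorem masseyDeg_self (n : ℕ → ℤ) (i : ℕ) : masseyDeg n i i = n i := by simp [masseyDeg]

/-- The Massey sum, indexed by the first entry `c` of the second factor. -/
theorem masseySum_eq (n : ℕ → ℤ) (M : ℕ → ℕ → W) (i e : ℕ) :
    masseySum n M i (e - 1) = ∑ c ∈ Finset.Ioo i e,
      sgn (masseyDeg n i (c - 1) + 1) • (M i (c - 1) * M c (e - 1)) := by
  rw [masseySum]
  refine Finset.sum_nbij' (· + 1) (· - 1) ?_ ?_ ?_ ?_ ?_ <;> intro k hk <;>
    simp only [Finset.mem_Ico, Finset.mem_Ioo] at hk ⊢ <;> first | omega | simp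

variable {A : CDGA W} {r : ℕ} {n : ℕ → ℤ} {a : ℕ → W} {M : ℕ → ℕ → W}

/-- The entry of the half-open block `[i, e)`, whether or not it is diagonal. -/
theorem CDGA.IsDefiningSystem.mem_gr (h : A.IsDefiningSystem r n a M) {i e : ℕ} (hie : i < e)
    (he : e ≤ r) (hne : ¬ (i = 0 ∧ e = r)) : M i (e - 1) ∈ A.gr (masseyDeg n i (e - 1)) := by
  rcases eq_or_ne i (e - 1) with hi | hi
  · rw [← hi, masseyDeg_self]
    exact (h.diag_mem i (by omega)).1
  · exact h.mem _ _ (by omega) (by omega) (by omega)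

theorem CDGA.IsDefiningSystem.d_entry (h : A.IsDefiningSystem r n a M) {i e : ℕ} (hie : i < e)
    (he : e ≤ r) (hne : ¬ (i = 0 ∧ e = r)) :
    A.d (M i (e - 1)) = ∑ c ∈ Finset.Ioo i e,
      sgn (masseyDeg n i (c - 1) + 1) • (M i (c - 1) * M c (e - 1)) := by
  rcases eq_or_ne i (e - 1) with hi | hi
  · rw [← hi, Finset.sum_eq_zero]
    · exact (h.diag_mem i (by omega)).2
    · intro c hc
      rw [Finset.mem_Ioo] at hc; omega
  · rw [← masseySum_eq]
    exact h.d_eq _ _ (by omega) (by omega) (by omega)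

theorem CDGA.IsDefiningSystem.mul_mem_gr (h : A.IsDefiningSystem r n a M) {i c e : ℕ} (hic : i < c)
    (hce : c < e) (he : e ≤ r) :
    M i (c - 1) * M c (e - 1) ∈ A.gr (masseyDeg n i (e - 1) + 1) := by
  rw [← masseyDeg_add n hic hce]
  exact A.mul_mem (h.mem_gr hic (by omega) (by omega)) (h.mem_gr hce he (by omega))

theorem CDGA.IsDefiningSystem.masseySum_mem_cocycles (h : A.IsDefiningSystem r n a M)
    (hr : 1 ≤ r) :
    masseySum n M 0 (r - 1) ∈ A.cocycles (∑ k ∈ Finset.range r, n k - r + 2) := by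
  have hdeg : ∑ k ∈ Finset.range r, n k - r + 2 = masseyDeg n 0 (r - 1) + 1 := by
    have : Finset.Icc 0 (r - 1) = Finset.range r := by
      ext k; simp only [Finset.mem_Icc, Finset.mem_range]; omega
    rw [masseyDeg, this, Nat.cast_sub hr]
    push_cast
    ring
  rw [masseySum_eq]
  refine ⟨?_, ?_⟩
  · rw [hdeg]
    refine Submodule.sum_mem _ fun c hc => Submodule.smul_mem _ _ ?_
    rw [Finset.mem_Ioo] at hc
    exact h.mul_mem_gr hc.1 hc.2 le_rfl
  · change A.d _ = 0
    -- every triple product `M 0 (b - 1) * M b (c - 1) * M c (r - 1)` occurs twice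
    let T : ℕ → ℕ → W := fun b c => sgn (masseyDeg n b (c - 1)) •
      (M 0 (b - 1) * M b (c - 1) * M c (r - 1))
    have h1 : ∀ c ∈ Finset.Ioo 0 r,
        A.d (sgn (masseyDeg n 0 (c - 1) + 1) • (M 0 (c - 1) * M c (r - 1))) =
          (∑ b ∈ Finset.Ioo 0 c, -T b c) + ∑ b ∈ Finset.Ioo c r, T c b := by
      intro c hc
      rw [Finset.mem_Ioo] at hc
      rw [map_smul, A.leibniz (h.mem_gr hc.1 hc.2.le (by omega)) (h.mem_gr hc.2 le_rfl (by omega)),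
        h.d_entry hc.1 hc.2.le (by omega), h.d_entry hc.2 le_rfl (by omega), smul_add,
        Finset.sum_mul, Finset.mul_sum, Finset.smul_sum, Finset.smul_sum, Finset.smul_sum]
      congr 1
      · refine Finset.sum_congr rfl fun b hb => ?_
        rw [Finset.mem_Ioo] at hb
        simp only [T]
        rw [smul_mul_assoc, smul_smul, ← sgn_add, ← neg_smul, neg_sgn]
        congr 1
        apply sgn_congr
        have := masseyDeg_add n hb.1 hb.2
        have e : masseyDeg n 0 (c - 1) = masseyDeg n 0 (b - 1) + masseyDeg n b (c - 1) - 1 := by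
          omega
        rw [e]
        push_cast
        generalize (masseyDeg n 0 (b - 1) : ZMod 2) = x
        generalize (masseyDeg n b (c - 1) : ZMod 2) = y
        revert x y; decide
      · refine Finset.sum_congr rfl fun b hb => ?_
        simp only [T]
        rw [mul_smul_comm, smul_smul, smul_smul, ← sgn_add, ← sgn_add, mul_assoc]
        congr 1
        apply sgn_congr
        push_cast
        generalize (masseyDeg n 0 (c - 1) : ZMod 2) = x
        generalize (masseyDeg n c (b - 1) : ZMod 2) = y
        revert x y; decide
    rw [map_sum, Finset.sum_congr rfl h1, Finset.sum_add_distrib]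
    have h2 : ∑ c ∈ Finset.Ioo 0 r, ∑ b ∈ Finset.Ioo 0 c, -T b c =
        ∑ c ∈ Finset.Ioo 0 r, ∑ b ∈ Finset.Ioo c r, -T c b := by
      refine Finset.sum_comm' fun c b => ?_
      simp only [Finset.mem_Ioo]; omega
    rw [h2, ← Finset.sum_add_distrib]
    refine Finset.sum_eq_zero fun c _ => ?_
    rw [← Finset.sum_add_distrib]
    exact Finset.sum_eq_zero fun b _ => neg_add_cancel _

/-! ### Cutting an interval into blocks -/

/-- The largest cut below `j`, or `0`: the start of the block that ends just before `j` when the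
interval `[0, r)` is cut at the elements of `C`. -/
def prevCut (C : Finset ℕ) (j : ℕ) : ℕ := (C.filter (· < j)).sup id

/-- The smallest cut above `k`, or `r`: one more than the last element of the block that starts at
`k` when the interval `[0, r)` is cut at the elements of `C`. -/
def nextCut (r : ℕ) (C : Finset ℕ) (k : ℕ) : ℕ := sInf {m | k < m ∧ (m ∈ C ∨ r ≤ m)}

theorem prevCut_eq {C : Finset ℕ} {j k : ℕ} (hk : k ∈ insert 0 C) (hkj : k < j)
    (h : ∀ x ∈ C, x < j → x ≤ k) : prevCut C j = k := by
  refine le_antisymm (Finset.sup_le fun x hx => ?_) ?_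
  · rw [Finset.mem_filter] at hx
    exact h x hx.1 hx.2
  · rcases Finset.mem_insert.1 hk with rfl | hk
    · exact Nat.zero_le _
    · exact Finset.le_sup (f := id) (Finset.mem_filter.2 ⟨hk, hkj⟩)

theorem le_prevCut {C : Finset ℕ} {j x : ℕ} (hx : x ∈ C) (hxj : x < j) : x ≤ prevCut C j :=
  Finset.le_sup (f := id) (Finset.mem_filter.2 ⟨hx, hxj⟩)

theorem prevCut_lt {C : Finset ℕ} {j : ℕ} (hj : 0 < j) : prevCut C j < j :=
  (Finset.sup_lt_iff hj).2 fun _ hx => (Finset.mem_filter.1 hx).2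

theorem prevCut_mem (C : Finset ℕ) (j : ℕ) : prevCut C j ∈ insert 0 C := by
  rcases (C.filter (· < j)).eq_empty_or_nonempty with h | h
  · simp [prevCut, h]
  · obtain ⟨x, hx, hx'⟩ := Finset.exists_mem_eq_sup _ h id
    rw [prevCut, hx']
    exact Finset.mem_insert_of_mem (Finset.mem_filter.1 hx).1

theorem lt_nextCut (r : ℕ) (C : Finset ℕ) (k : ℕ) : k < nextCut r C k :=
  (Nat.sInf_mem (s := {m | k < m ∧ (m ∈ C ∨ r ≤ m)}) ⟨k + 1 + r, by omega, by omega⟩).1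

theorem nextCut_mem_or (r : ℕ) (C : Finset ℕ) (k : ℕ) : nextCut r C k ∈ C ∨ r ≤ nextCut r C k :=
  (Nat.sInf_mem (s := {m | k < m ∧ (m ∈ C ∨ r ≤ m)}) ⟨k + 1 + r, by omega, by omega⟩).2

theorem nextCut_le {r : ℕ} {C : Finset ℕ} {k m : ℕ} (hkm : k < m) (hm : m ∈ C ∨ r ≤ m) :
    nextCut r C k ≤ m := Nat.sInf_le ⟨hkm, hm⟩

theorem nextCut_eq {r : ℕ} {C : Finset ℕ} {k m : ℕ} (hkm : k < m) (hm : m ∈ C ∨ r ≤ m)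
    (h : ∀ x, k < x → (x ∈ C ∨ r ≤ x) → m ≤ x) : nextCut r C k = m :=
  le_antisymm (nextCut_le hkm hm) (h _ (lt_nextCut r C k) (nextCut_mem_or r C k))

/-- The block that starts at `k` consists of the `x` whose preceding start is `k`. -/
theorem prevCut_succ_eq_iff {C : Finset ℕ} {k x : ℕ} (hx : x < r) (hk : k ∈ insert 0 C) :
    prevCut C (x + 1) = k ↔ k ≤ x ∧ x < nextCut r C k := by
  have hx0 : prevCut C (x + 1) < x + 1 := prevCut_lt (by omega)
  constructor
  · rintro rfl
    refine ⟨by omega, ?_⟩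
    by_contra! hlt
    rcases nextCut_mem_or r C (prevCut C (x + 1)) with h | h
    · have := le_prevCut h (j := x + 1) (by omega)
      have := lt_nextCut r C (prevCut C (x + 1))
      omega
    · omega
  · rintro ⟨h1, h2⟩
    refine prevCut_eq hk (by omega) fun y hy hyx => ?_
    by_contra! hlt
    have := nextCut_le (r := r) hlt (Or.inl hy)
    omega

/-- The interval `[0, r)` is the disjoint union of the blocks. -/
theorem sum_blocks {G : Type*} [AddCommMonoid G] {C : Finset ℕ} (hr : 0 < r)
    (hC : C ⊆ Finset.Ico 1 r)
    (f : ℕ → G) :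
    ∑ k ∈ insert 0 C, ∑ x ∈ Finset.Ico k (nextCut r C k), f x = ∑ x ∈ Finset.range r, f x := by
  rw [← Finset.sum_fiberwise_of_maps_to (s := Finset.range r) (t := insert 0 C)
    (g := fun x => prevCut C (x + 1)) fun x _ => prevCut_mem C (x + 1)]
  refine Finset.sum_congr rfl fun k hk => Finset.sum_congr ?_ fun _ _ => rfl
  ext x
  rw [Finset.mem_filter, Finset.mem_Ico, Finset.mem_range]
  refine ⟨fun hx => ?_, fun hx => (prevCut_succ_eq_iff hx.1 hk).1 hx.2⟩
  have hkr : k < r := by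
    rcases Finset.mem_insert.1 hk with rfl | hk
    · exact hr
    · exact (Finset.mem_Ico.1 (hC hk)).2
  have hxr : x < r := by
    have := nextCut_le (C := C) hkr (Or.inr le_rfl)
    omega
  exact ⟨hxr, (prevCut_succ_eq_iff hxr hk).2 hx⟩

section Insert

variable {C : Finset ℕ} {c : ℕ}

theorem prevCut_insert_self : prevCut (insert c C) c = prevCut C c := by
  rw [prevCut, Finset.filter_insert, if_neg (lt_irrefl c), prevCut]

/-- Contracting the arrow into `c` turns the arrows between the blocks of `insert c C` into those
between the blocks of `C`. -/
theorem collapse_prevCut_insert {j : ℕ} (hc : 0 < c) (hcC : c ∉ C) (hj : j ∈ C) :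
    collapse (prevCut C c) c (prevCut (insert c C) j) = prevCut C j := by
  have hkc : prevCut C c < c := prevCut_lt hc
  have hj' : j ≠ c := fun h => hcC (h ▸ hj)
  rcases lt_or_gt_of_ne hj' with hlt | hlt
  · have h1 : prevCut (insert c C) j = prevCut C j := by
      rw [prevCut, Finset.filter_insert, if_neg hlt.not_gt, prevCut]
    have h2 : prevCut C j < c := by
      rcases Nat.eq_zero_or_pos j with rfl | h0
      · simpa [prevCut] using hc
      · exact (prevCut_lt h0).trans hlt
    rw [h1, collapse, if_neg h2.ne]
  · have h1 : prevCut (insert c C) j = c ⊔ prevCut C j := by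
      rw [prevCut, Finset.filter_insert, if_pos hlt, Finset.sup_insert, prevCut]
      rfl
    rcases le_or_gt (prevCut C j) c with h | h
    · have h2 : prevCut C c = prevCut C j := by
        have hne : prevCut C j ≠ c := fun h' => by
          have := prevCut_mem C j
          rw [h', Finset.mem_insert] at this
          rcases this with h0 | h0
          · omega
          · exact hcC h0
        exact prevCut_eq (prevCut_mem C j) (lt_of_le_of_ne h hne)
          fun x hx hxc => le_prevCut hx (by omega)
      rw [h1, max_eq_left h, collapse, if_pos rfl, h2]
    · rw [h1, max_eq_right h.le, collapse, if_neg h.ne']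

theorem nextCut_insert_prevCut (hc : 0 < c) (hcr : c < r) :
    nextCut r (insert c C) (prevCut C c) = c := by
  refine nextCut_eq (prevCut_lt hc) (Or.inl (Finset.mem_insert_self c C)) fun x hx h => ?_
  by_contra! hlt
  rcases h with h | h
  · rcases Finset.mem_insert.1 h with rfl | h
    · omega
    · have := le_prevCut h hlt
      omega
  · omega

theorem lt_nextCut_prevCut (hcC : c ∉ C) (hcr : c < r) : c < nextCut r C (prevCut C c) := by
  by_contra! hle
  have h1 := lt_nextCut r C (prevCut C c)
  rcases nextCut_mem_or r C (prevCut C c) with h | h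
  · have h2 : nextCut r C (prevCut C c) ≠ c := fun h' => hcC (h' ▸ h)
    have := le_prevCut h (lt_of_le_of_ne hle h2)
    omega
  · omega

theorem nextCut_insert_self (hc : 0 < c) (hcC : c ∉ C) (hcr : c < r) :
    nextCut r (insert c C) c = nextCut r C (prevCut C c) := by
  refine nextCut_eq (lt_nextCut_prevCut hcC hcr)
    ((nextCut_mem_or r C _).imp_left Finset.mem_insert_of_mem) fun x hx h => ?_
  refine nextCut_le ((prevCut_lt hc).trans hx) (h.imp_left fun h => ?_)
  exact Finset.mem_of_mem_insert_of_ne h hx.ne'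

theorem nextCut_insert_of_ne {x : ℕ} (hx : x ∈ insert 0 C) (hxc : x ≠ prevCut C c)
    (hcC : c ∉ C) (hcr : c < r) : nextCut r (insert c C) x = nextCut r C x := by
  refine nextCut_eq (lt_nextCut r C x) ?_ fun y hxy h => ?_
  · exact (nextCut_mem_or r C x).imp_left Finset.mem_insert_of_mem
  · rcases h with h | h
    · rcases Finset.mem_insert.1 h with rfl | h
      · -- a cut strictly between `x` and `y`
        by_contra! hlt
        refine hxc (prevCut_eq hx hxy fun z hz hzy => ?_).symm
        by_contra! hxz
        have := nextCut_le (r := r) hxz (Or.inl hz)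
        omega
      · exact nextCut_le hxy (Or.inl h)
    · exact nextCut_le hxy (Or.inr h)

end Insert

/-! ### The graphs of the cuttings -/

/-- The graph obtained by cutting the interval `[0, r)` at the elements of `C`. There is one vertex
for each block, namely the first element of the block; consecutive blocks are joined by an arrow;
and the block `[k, e)` carries the label `M k (e - 1)`. -/
def blockGraph (r : ℕ) (n : ℕ → ℤ) (M : ℕ → ℕ → W) (C : Finset ℕ) : LGraph W where
  verts := insert 0 C
  edges := C.val.map fun j => (prevCut C j, j)
  deg k := masseyDeg n k (nextCut r C k - 1)
  lab k := M k (nextCut r C k - 1)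

/-- The graph of `blockGraph r n M C` in which the block containing the cut `c` carries the
product of the labels of its two halves, with the sign with which it occurs in the differential
of that graph. -/
def CDGA.splitTerm (A : CDGA W) (r : ℕ) (n : ℕ → ℤ) (M : ℕ → ℕ → W) (C : Finset ℕ) (c : ℕ) :
    A.LieCoalg :=
  sgn (before (insert 0 C) (blockGraph r n M C).deg (prevCut C c) +
      (masseyDeg n (prevCut C c) (c - 1) + 1)) •
    A.gen ⟨insert 0 C, (blockGraph r n M C).edges,
      Function.update (blockGraph r n M C).deg (prevCut C c)
        ((blockGraph r n M C).deg (prevCut C c) + 1),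
      Function.update (blockGraph r n M C).lab (prevCut C c)
        (M (prevCut C c) (c - 1) * M c (nextCut r C (prevCut C c) - 1))⟩

theorem isTree_blockGraph {C : Finset ℕ} (hC : C ⊆ Finset.Ico 1 r) :
    IsTree (blockGraph r n M C).verts (blockGraph r n M C).edges := by
  have hpos : ∀ j ∈ C, 0 < j := fun j hj => (Finset.mem_Ico.1 (hC hj)).1
  refine ⟨?_, ?_, ?_⟩
  · intro e he
    obtain ⟨j, hj, rfl⟩ := Multiset.mem_map.1 he
    exact ⟨prevCut_mem C j, Finset.mem_insert_of_mem hj⟩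
  · have key : ∀ x, x ∈ insert 0 C → Relation.EqvGen
        (fun x y : ℕ => (x, y) ∈ (blockGraph r n M C).edges) 0 x := by
      intro x
      induction x using Nat.strong_induction_on with
      | _ x ih =>
        intro hx
        rcases Finset.mem_insert.1 hx with rfl | hx
        · exact .refl _
        · exact .trans _ _ _ (ih _ (prevCut_lt (hpos x hx)) (prevCut_mem C x))
            (.rel _ _ (Multiset.mem_map.2 ⟨x, hx, rfl⟩))
    exact fun x hx y hy => .trans _ _ _ (.symm _ _ (key x hx)) (key y hy)
  · rw [blockGraph, Multiset.card_map, Finset.card_insert_of_notMem fun h => (hpos 0 h).ne rfl]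
    rfl

/-- With at least one cut, no block carries the missing entry `(0, r - 1)` of a defining system. -/
theorem block_ne {C : Finset ℕ} (hC : C ⊆ Finset.Ico 1 r) (hne : C.Nonempty) (k : ℕ) :
    ¬ (k = 0 ∧ nextCut r C k = r) := by
  rintro ⟨rfl, h⟩
  obtain ⟨c, hc⟩ := hne
  have h1 := Finset.mem_Ico.1 (hC hc)
  have := nextCut_le (r := r) (k := 0) (by omega) (Or.inl hc)
  omega

theorem lt_of_mem_verts {C : Finset ℕ} (hr : 1 ≤ r) (hC : C ⊆ Finset.Ico 1 r) {k : ℕ}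
    (hk : k ∈ insert 0 C) : k < r := by
  rcases Finset.mem_insert.1 hk with rfl | hk
  · omega
  · exact (Finset.mem_Ico.1 (hC hk)).2

namespace CDGA.IsDefiningSystem

variable {C : Finset ℕ}

theorem valid_blockGraph (h : A.IsDefiningSystem r n a M) (hr : 1 ≤ r)
    (hC : C ⊆ Finset.Ico 1 r) (hne : C.Nonempty) : A.Valid (blockGraph r n M C) :=
  ⟨isTree_blockGraph hC, fun k hk => h.mem_gr (lt_nextCut r C k)
    (nextCut_le (lt_of_mem_verts hr hC hk) (Or.inr le_rfl)) (block_ne hC hne k)⟩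

/-- The label of a block has the sum of the desuspended degrees `n x - 1` over the block as its
desuspended degree, so all the block graphs have the same total degree. -/
theorem blockGraph_mem_fil (h : A.IsDefiningSystem r n a M) (hr : 1 ≤ r)
    (hC : C ⊆ Finset.Ico 1 r) (hne : C.Nonempty) {p : ℤ} (hp : (C.card : ℤ) ≤ -p) :
    A.gen (blockGraph r n M C) ∈ A.fil p (1 - r + ∑ k ∈ Finset.range r, n k) := by
  have hcard : (insert 0 C).card = C.card + 1 :=
    Finset.card_insert_of_notMem fun h0 => by have := Finset.mem_Ico.1 (hC h0); omega
  refine A.gen_mem_fil (h.valid_blockGraph hr hC hne) ?_ ?_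
  · change ((insert 0 C).card : ℤ) ≤ _
    rw [hcard]
    push_cast
    linarith
  · have h1 : ∀ k ∈ insert 0 C, masseyDeg n k (nextCut r C k - 1) - 1 =
        ∑ x ∈ Finset.Ico k (nextCut r C k), (n x - 1) := by
      intro k _
      have hlt := lt_nextCut r C k
      have : Finset.Icc k (nextCut r C k - 1) = Finset.Ico k (nextCut r C k) := by
        ext x; simp only [Finset.mem_Icc, Finset.mem_Ico]; omega
      rw [masseyDeg, this, Finset.sum_sub_distrib, Finset.sum_const, Nat.card_Ico, nsmul_one,
        Nat.cast_sub (by omega), Nat.cast_sub hlt.le]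
      push_cast
      ring
    have h2 := sum_blocks (r := r) hr hC fun x => n x - 1
    rw [← Finset.sum_congr rfl h1, Finset.sum_sub_distrib, Finset.sum_sub_distrib] at h2
    simp only [Finset.sum_const, nsmul_one, Finset.card_range] at h2
    change ∑ k ∈ insert 0 C, masseyDeg n k (nextCut r C k - 1) + (1 - ((insert 0 C).card : ℤ)) = _
    linarith

end CDGA.IsDefiningSystem

theorem CDGA.gen_update_sum (A : CDGA W) {S : Finset ℕ} {E : Multiset (ℕ × ℕ)} {p : ℕ → ℤ}
    {w : ℕ → W} {k : ℕ} (hk : k ∈ S) {ι : Type*} (s : Finset ι) (c : ι → ℚ) (x : ι → W)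
    (hx : ∀ i ∈ s, x i ∈ A.gr (p k)) :
    A.gen ⟨S, E, p, Function.update w k (∑ i ∈ s, c i • x i)⟩ =
      ∑ i ∈ s, c i • A.gen ⟨S, E, p, Function.update w k (x i)⟩ := by
  classical
  induction s using Finset.induction_on with
  | empty => simp only [Finset.sum_empty]; exact A.gen_zero hk
  | insert i s hi ih =>
    have hx' : ∀ j ∈ s, x j ∈ A.gr (p k) := fun j hj => hx j (Finset.mem_insert_of_mem hj)
    have hi' := hx i (Finset.mem_insert_self i s)
    rw [Finset.sum_insert hi, Finset.sum_insert hi, A.gen_add hk (Submodule.smul_mem _ _ hi')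
      (Submodule.sum_mem _ fun j hj => Submodule.smul_mem _ _ (hx' j hj)), A.gen_smul _ hk hi',
      ih hx']

/-! ### The differential of the sum over all cuttings -/

/-- The new cuts that split the block starting at `k` are the interior points of that block. -/
theorem filter_prevCut_eq {C : Finset ℕ} (hr : 1 ≤ r) (hC : C ⊆ Finset.Ico 1 r) {k : ℕ}
    (hk : k ∈ insert 0 C) :
    (Finset.Ico 1 r \ C).filter (fun c => prevCut C c = k) = Finset.Ioo k (nextCut r C k) := by
  have hkr := nextCut_le (r := r) (C := C) (lt_of_mem_verts hr hC hk) (Or.inr le_rfl)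
  ext c
  simp only [Finset.mem_filter, Finset.mem_sdiff, Finset.mem_Ico, Finset.mem_Ioo]
  constructor
  · rintro ⟨⟨⟨h1, h2⟩, h3⟩, rfl⟩
    exact ⟨prevCut_lt h1, lt_nextCut_prevCut h3 h2⟩
  · rintro ⟨h1, h2⟩
    refine ⟨⟨⟨by omega, by omega⟩, fun h => ?_⟩, prevCut_eq hk h1 fun x hx hxc => ?_⟩
    · have := nextCut_le (r := r) h1 (Or.inl h)
      omega
    · by_contra! hlt
      have := nextCut_le (r := r) hlt (Or.inl hx)
      omega

namespace CDGA.IsDefiningSystem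

variable {C : Finset ℕ}

theorem sum_splitTerm (h : A.IsDefiningSystem r n a M) (hr : 1 ≤ r) (hC : C ⊆ Finset.Ico 1 r)
    {k : ℕ} (hk : k ∈ insert 0 C) :
    ∑ c ∈ Finset.Ioo k (nextCut r C k), A.splitTerm r n M C c =
      sgn (before (insert 0 C) (blockGraph r n M C).deg k) •
        A.gen ⟨insert 0 C, (blockGraph r n M C).edges,
          Function.update (blockGraph r n M C).deg k ((blockGraph r n M C).deg k + 1),
          Function.update (blockGraph r n M C).lab k (masseySum n M k (nextCut r C k - 1))⟩ := by
  have hkr := nextCut_le (r := r) (C := C) (lt_of_mem_verts hr hC hk) (Or.inr le_rfl)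
  rw [masseySum_eq, A.gen_update_sum hk, Finset.smul_sum]
  · refine Finset.sum_congr rfl fun c hc => ?_
    have hp : prevCut C c = k := by
      rw [← filter_prevCut_eq hr hC hk] at hc
      exact (Finset.mem_filter.1 hc).2
    rw [splitTerm, hp, sgn_add, mul_smul]
  · intro c hc
    rw [Finset.mem_Ioo] at hc
    rw [Function.update_self]
    exact h.mul_mem_gr hc.1 hc.2 hkr

/-- By the equations of the defining system, the internal differential splits the blocks. -/
theorem dW_blockGraph (h : A.IsDefiningSystem r n a M) (hr : 1 ≤ r) (hC : C ⊆ Finset.Ico 1 r)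
    (hne : C.Nonempty) :
    A.dW (A.gen (blockGraph r n M C)) = ∑ c ∈ Finset.Ico 1 r \ C, A.splitTerm r n M C c := by
  rw [A.dW_gen (h.valid_blockGraph hr hC hne), ← Finset.sum_fiberwise_of_maps_to
    (s := Finset.Ico 1 r \ C) (t := insert 0 C) (g := prevCut C) fun c _ => prevCut_mem C c]
  refine Finset.sum_congr rfl fun k hk => ?_
  rw [filter_prevCut_eq hr hC hk, h.sum_splitTerm hr hC hk, masseySum_eq, ← h.d_entry
    (lt_nextCut r C k) (nextCut_le (lt_of_mem_verts hr hC hk) (Or.inr le_rfl)) (block_ne hC hne k)]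
  rfl

end CDGA.IsDefiningSystem

/-- Contracting the arrow into the start `c` of a block removes the cut `c`. -/
theorem CDGA.mu_blockGraph (A : CDGA W) {C : Finset ℕ} {c : ℕ}
    (hcC : c ∉ C) (hc : c ∈ Finset.Ico 1 r) :
    A.mu (blockGraph r n M (insert c C)) (prevCut C c) c = -A.splitTerm r n M C c := by
  obtain ⟨hc0, hcr⟩ := Finset.mem_Ico.1 hc
  have hkc : prevCut C c < c := prevCut_lt hc0
  have hkC := prevCut_mem C c
  have hcC' : c ∉ insert 0 C := by
    rw [Finset.mem_insert, not_or]
    exact ⟨by omega, hcC⟩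
  have hkS : prevCut C c ∈ insert c (insert 0 C) := Finset.mem_insert_of_mem hkC
  have hS : insert 0 (insert c C) = insert c (insert 0 C) := Finset.insert_comm _ _ _
  have hSe : (insert 0 (insert c C)).erase c = insert 0 C := by
    rw [hS, Finset.erase_insert hcC']
  have hnk := nextCut_insert_prevCut (C := C) hc0 hcr
  have hnc := nextCut_insert_self hc0 hcC hcr
  have hdk : (blockGraph r n M (insert c C)).deg (prevCut C c) =
      masseyDeg n (prevCut C c) (c - 1) := by simp only [blockGraph, hnk]
  have hdeg : ∀ x ∈ insert 0 C, x ≠ prevCut C c →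
      (blockGraph r n M (insert c C)).deg x = (blockGraph r n M C).deg x := fun x hx hne => by
    simp only [blockGraph, nextCut_insert_of_ne hx hne hcC hcr]
  have hE : ((blockGraph r n M (insert c C)).edges.erase (prevCut C c, c)).map
      (Prod.map (collapse (prevCut C c) c) (collapse (prevCut C c) c)) =
        (blockGraph r n M C).edges := by
    simp only [blockGraph]
    rw [Finset.insert_val_of_notMem hcC, Multiset.map_cons, prevCut_insert_self,
      Multiset.erase_cons_head, Multiset.map_map]
    refine Multiset.map_congr rfl fun j hj => ?_
    have hjc : j ≠ c := fun h => hcC (h ▸ hj)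
    rw [Function.comp_apply, Prod.map_apply, collapse_prevCut_insert hc0 hcC hj, collapse,
      if_neg hjc]
  have hgen : A.gen ((blockGraph r n M (insert c C)).contract (prevCut C c) c) =
      A.gen ⟨insert 0 C, (blockGraph r n M C).edges,
        Function.update (blockGraph r n M C).deg (prevCut C c)
          ((blockGraph r n M C).deg (prevCut C c) + 1),
        Function.update (blockGraph r n M C).lab (prevCut C c)
          (M (prevCut C c) (c - 1) * M c (nextCut r C (prevCut C c) - 1))⟩ := by
    rw [LGraph.contract, hE]
    change A.gen ⟨(insert 0 (insert c C)).erase c, _, _, _⟩ = _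
    rw [hSe]
    refine A.gen_congr (fun x hx => ?_) fun x hx => ?_ <;>
      rcases eq_or_ne x (prevCut C c) with rfl | hne
    · rw [Function.update_self, Function.update_self]
      simp only [blockGraph, hnk, hnc]
      exact (masseyDeg_add n hkc (lt_nextCut_prevCut hcC hcr)).symm
    · rw [Function.update_of_ne hne, Function.update_of_ne hne, hdeg x hx hne]
    · rw [Function.update_self, Function.update_self]
      simp only [blockGraph, hnk, hnc]
    · rw [Function.update_of_ne hne, Function.update_of_ne hne]
      simp only [blockGraph, nextCut_insert_of_ne hx hne hcC hcr]
  rw [mu, hgen, splitTerm, ← neg_smul, neg_sgn]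
  congr 1
  apply sgn_congr
  change (contractExp (insert 0 (insert c C)) (blockGraph r n M (insert c C)).deg _ c : ZMod 2) = _
  -- the vertices before `prevCut C c`, on which neither the cut nor the degrees have changed
  have hb : before (insert 0 C) (blockGraph r n M C).deg (prevCut C c) =
      before (insert 0 C) (blockGraph r n M (insert c C)).deg (prevCut C c) := by
    refine Finset.sum_congr rfl fun x hx => ?_
    split_ifs with hlt
    · rw [hdeg x hx hlt.ne]
    · rfl
  have hb1 : before (insert c (insert 0 C)) (blockGraph r n M (insert c C)).deg (prevCut C c) =
      before (insert 0 C) (blockGraph r n M (insert c C)).deg (prevCut C c) := by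
    rw [before, Finset.sum_insert hcC', if_neg hkc.not_gt, zero_add, before]
  have hb2 : before ((insert c (insert 0 C)).erase (prevCut C c))
      (blockGraph r n M (insert c C)).deg c =
        before (insert 0 C) (blockGraph r n M (insert c C)).deg (prevCut C c) := by
    rw [before_erase hkS, if_pos hkc, before, Finset.sum_insert hcC', if_neg (lt_irrefl c),
      zero_add, before, ← Finset.add_sum_erase _ _ hkC, if_pos hkc, add_sub_cancel_left,
      ← Finset.add_sum_erase (insert 0 C) _ hkC, if_neg (lt_irrefl _), zero_add]
    refine Finset.sum_congr rfl fun x hx => ?_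
    obtain ⟨hxk, hx⟩ := Finset.mem_erase.1 hx
    have : x < c ↔ x < prevCut C c := by
      refine ⟨fun hxc => lt_of_le_of_ne ?_ hxk, fun hxc => hxc.trans hkc⟩
      rcases Finset.mem_insert.1 hx with rfl | hx
      · exact Nat.zero_le _
      · exact le_prevCut hx hxc
    simp only [this]
  rw [contractExp, hSe, hS, hb1, hb2, hb, hdk]
  push_cast
  generalize (before (insert 0 C) (blockGraph r n M (insert c C)).deg (prevCut C c) : ZMod 2) = x
  generalize (masseyDeg n (prevCut C c) (c - 1) : ZMod 2) = y
  generalize ((blockGraph r n M (insert c C)).deg c : ZMod 2) = z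
  revert x y z; decide

/-- The multiplicative differential merges adjacent blocks, with the sign opposite to that of the
corresponding splitting in the internal differential. -/
theorem CDGA.IsDefiningSystem.dMu_blockGraph (h : A.IsDefiningSystem r n a M) (hr : 1 ≤ r)
    {C : Finset ℕ} (hC : C ⊆ Finset.Ico 1 r) (hne : C.Nonempty) :
    A.dMu (A.gen (blockGraph r n M C)) = -∑ c ∈ C, A.splitTerm r n M (C.erase c) c := by
  rw [A.dMu_gen (h.valid_blockGraph hr hC hne), ← Finset.sum_neg_distrib]
  simp only [blockGraph, Multiset.map_map]
  refine Finset.sum_congr rfl fun c hc => ?_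
  have hm := A.mu_blockGraph (n := n) (M := M) (Finset.notMem_erase c C) (hC hc)
  rw [← prevCut_insert_self, Finset.insert_erase hc] at hm
  exact hm

/-- Adding a cut and removing a cut are inverse operations. -/
theorem sum_powerset_erase {G : Type*} [AddCommMonoid G] (I : Finset ℕ) (f : Finset ℕ → ℕ → G) :
    ∑ C ∈ I.powerset, ∑ c ∈ C, f (C.erase c) c = ∑ C ∈ I.powerset, ∑ c ∈ I \ C, f C c := by
  rw [Finset.sum_sigma', Finset.sum_sigma']
  refine Finset.sum_bij' (fun x _ => ⟨x.1.erase x.2, x.2⟩) (fun x _ => ⟨insert x.2 x.1, x.2⟩)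
    ?_ ?_ ?_ ?_ ?_
  · rintro ⟨C, c⟩ hx
    simp only [Finset.mem_sigma, Finset.mem_powerset, Finset.mem_sdiff] at hx ⊢
    exact ⟨(Finset.erase_subset c C).trans hx.1, hx.1 hx.2, Finset.notMem_erase c C⟩
  · rintro ⟨C, c⟩ hx
    simp only [Finset.mem_sigma, Finset.mem_powerset, Finset.mem_sdiff] at hx ⊢
    exact ⟨Finset.insert_subset hx.2.1 hx.1, Finset.mem_insert_self c C⟩
  · rintro ⟨C, c⟩ hx
    simp only [Finset.mem_sigma] at hx
    simp only [Finset.insert_erase hx.2]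
  · rintro ⟨C, c⟩ hx
    simp only [Finset.mem_sigma, Finset.mem_sdiff] at hx
    simp only [Finset.erase_insert hx.2.2]
  · rintro ⟨C, c⟩ _
    rfl

/-- The sum of the block graphs of all the ways to cut the interval `[0, r)` into at least two
blocks. -/
def CDGA.cutSum (A : CDGA W) (r : ℕ) (n : ℕ → ℤ) (M : ℕ → ℕ → W) : A.LieCoalg :=
  ∑ C ∈ (Finset.Ico 1 r).powerset.erase ∅, A.gen (blockGraph r n M C)

namespace CDGA.IsDefiningSystem

/-- The splittings of the blocks cancel against the merged blocks, except where merging leaves the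
single block `[0, r)`, whose graph is not a summand of `cutSum`. -/
theorem D_cutSum_eq_sum (h : A.IsDefiningSystem r n a M) (hr : 1 ≤ r) :
    A.D (A.cutSum r n M) = -∑ c ∈ Finset.Ico 1 r, A.splitTerm r n M ∅ c := by
  have h0 : ∅ ∈ (Finset.Ico 1 r).powerset := Finset.empty_mem_powerset _
  have h1 : A.dW (A.cutSum r n M) = ∑ C ∈ (Finset.Ico 1 r).powerset.erase ∅,
      ∑ c ∈ Finset.Ico 1 r \ C, A.splitTerm r n M C c := by
    rw [cutSum, map_sum]
    refine Finset.sum_congr rfl fun C hC => ?_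
    obtain ⟨hne, hC⟩ := Finset.mem_erase.1 hC
    exact h.dW_blockGraph hr (Finset.mem_powerset.1 hC) (Finset.nonempty_iff_ne_empty.2 hne)
  have h2 : A.dMu (A.cutSum r n M) = -∑ C ∈ (Finset.Ico 1 r).powerset.erase ∅,
      ∑ c ∈ C, A.splitTerm r n M (C.erase c) c := by
    rw [cutSum, map_sum, ← Finset.sum_neg_distrib]
    refine Finset.sum_congr rfl fun C hC => ?_
    obtain ⟨hne, hC⟩ := Finset.mem_erase.1 hC
    exact h.dMu_blockGraph hr (Finset.mem_powerset.1 hC) (Finset.nonempty_iff_ne_empty.2 hne)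
  have h3 := sum_powerset_erase (Finset.Ico 1 r) (A.splitTerm r n M)
  rw [← Finset.add_sum_erase _ _ h0, Finset.sum_empty, zero_add, ← Finset.add_sum_erase _ _ h0,
    Finset.sdiff_empty] at h3
  rw [D, LinearMap.add_apply, h1, h2, h3]
  abel

theorem D_cutSum (h : A.IsDefiningSystem r n a M) (hr : 1 ≤ r) :
    A.D (A.cutSum r n M) = -A.vertex (∑ k ∈ Finset.range r, n k - r + 2)
      ⟨masseySum n M 0 (r - 1), (h.masseySum_mem_cocycles hr).1⟩ := by
  have hn : nextCut r ∅ 0 = r := nextCut_eq (by omega) (Or.inr le_rfl) fun x _ hx => by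
    simpa using hx
  have hs := h.sum_splitTerm hr (Finset.empty_subset _) (Finset.mem_insert_self 0 ∅)
  have hI : Finset.Ioo 0 r = Finset.Ico 1 r := by
    ext x; simp only [Finset.mem_Ioo, Finset.mem_Ico]; omega
  rw [hn, hI] at hs
  rw [h.D_cutSum_eq_sum hr, hs]
  have hb : before (insert 0 ∅) (blockGraph r n M ∅).deg 0 = 0 :=
    Finset.sum_eq_zero fun x _ => if_neg (Nat.not_lt_zero x)
  have hdeg : (blockGraph r n M ∅).deg 0 + 1 = ∑ k ∈ Finset.range r, n k - r + 2 := by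
    have : Finset.Icc 0 (r - 1) = Finset.range r := by
      ext k; simp only [Finset.mem_Icc, Finset.mem_range]; omega
    simp only [blockGraph, hn]
    rw [masseyDeg, this, Nat.cast_sub hr]
    push_cast
    ring
  rw [hb, sgn_zero, one_smul, hdeg]
  congr 1
  refine A.gen_congr (fun x hx => ?_) fun x hx => ?_ <;>
  · obtain rfl : x = 0 := by simpa using hx
    simp

/-- Modulo graphs with fewer than `r` vertices, only the cutting into singletons contributes. -/
theorem cutSum_sub_bar_mem_B_one (h : A.IsDefiningSystem r n a M) (hr : 2 ≤ r) :
    A.cutSum r n M - A.bar r n (fun i => M i i) ∈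
      A.B 1 (1 - r) (∑ k ∈ Finset.range r, n k) := by
  have hfull : Finset.Ico 1 r ∈ (Finset.Ico 1 r).powerset.erase ∅ :=
    Finset.mem_erase.2 ⟨(Finset.nonempty_Ico.2 (by omega)).ne_empty, Finset.mem_powerset_self _⟩
  have hbar : A.gen (blockGraph r n M (Finset.Ico 1 r)) = A.bar r n (fun i => M i i) := by
    have hv : insert 0 (Finset.Ico 1 r) = Finset.range r := by
      ext x; simp only [Finset.mem_insert, Finset.mem_Ico, Finset.mem_range]; omega
    have hE : (blockGraph r n M (Finset.Ico 1 r)).edges =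
        (Multiset.range (r - 1)).map fun i => (i, i + 1) := by
      have hI : (Finset.Ico 1 r).val = (Multiset.range (r - 1)).map (· + 1) := by
        have : Finset.Ico 1 r = (Finset.range (r - 1)).map (addRightEmbedding 1) := by
          ext x
          simp only [Finset.mem_Ico, Finset.mem_map, Finset.mem_range, addRightEmbedding_apply]
          exact ⟨fun hx => ⟨x - 1, by omega, by omega⟩, fun ⟨y, hy, hyx⟩ => by omega⟩
        rw [this]
        rfl
      simp only [blockGraph]
      rw [hI, Multiset.map_map]
      refine Multiset.map_congr rfl fun i hi => ?_
      rw [Multiset.mem_range] at hi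
      have : prevCut (Finset.Ico 1 r) (i + 1) = i :=
        prevCut_eq (by rw [hv, Finset.mem_range]; omega) (by omega) fun x _ hx => by omega
      simp only [Function.comp_apply, this]
    have hn : ∀ k ∈ Finset.range r, nextCut r (Finset.Ico 1 r) k = k + 1 := fun k hk => by
      rw [Finset.mem_range] at hk
      refine nextCut_eq (by omega) ?_ fun x hx _ => hx
      rw [Finset.mem_Ico]
      omega
    rw [bar, longGraph, ← hE, ← hv]
    refine A.gen_congr (fun k hk => ?_) fun k hk => ?_
    · rw [hv] at hk
      rw [hn k hk, Nat.add_sub_cancel, masseyDeg_self]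
    · rw [hv] at hk
      rw [hn k hk, Nat.add_sub_cancel]
  rw [cutSum, ← Finset.add_sum_erase _ _ hfull, hbar, add_sub_cancel_left]
  refine Submodule.sum_mem _ fun C hC => A.mem_B_one_of_mem_fil ?_
  simp only [Finset.mem_erase, Finset.mem_powerset] at hC
  obtain ⟨hfull, hne, hC⟩ := hC
  have hcard := Finset.card_lt_card (lt_of_le_of_ne hC hfull)
  rw [Nat.card_Ico] at hcard
  exact h.blockGraph_mem_fil (by omega) hC (Finset.nonempty_iff_ne_empty.2 hne) (by omega)

theorem cutSum_mem_Z (h : A.IsDefiningSystem r n a M) (hr : 1 ≤ r) {s : ℤ} (hs : s ≤ r - 1) :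
    A.cutSum r n M ∈ A.Z s (1 - r) (∑ k ∈ Finset.range r, n k) := by
  refine ⟨Submodule.sum_mem _ fun C hC => ?_, ?_⟩
  · obtain ⟨hne, hC⟩ := Finset.mem_erase.1 hC
    have hC := Finset.mem_powerset.1 hC
    have hcard := Finset.card_le_card hC
    rw [Nat.card_Ico] at hcard
    exact h.blockGraph_mem_fil hr hC (Finset.nonempty_iff_ne_empty.2 hne) (by omega)
  · rw [SetLike.mem_coe, Submodule.mem_comap, h.D_cutSum hr]
    have hv := (A.vertex_mem_Z (s := 0) ⟨_, h.masseySum_mem_cocycles hr⟩).1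
    refine neg_mem (A.fil_mono (p := 0) (by linarith) ?_)
    rw [SetLike.mem_coe] at hv
    rwa [show 1 - r + ∑ k ∈ Finset.range r, n k + 1 =
      0 + (∑ k ∈ Finset.range r, n k - r + 2) by ring]

end CDGA.IsDefiningSystem

end

theorem proposition4p4 {W : Type*} [NonUnitalRing W] [Module ℚ W] [IsScalarTower ℚ W W]
    [SMulCommClass ℚ W W] (A : CDGA W) (r : ℕ) (hr : 2 ≤ r) (n : ℕ → ℤ) (a : ℕ → W)
    (ha : ∀ i < r, a i ∈ A.cocycles (n i))
    (hdef : A.MasseyDefined r n a)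
    (hne : A.barClass (by omega : 1 ≤ r) ha ≠ 0) :
    (∃ y : A.Page (r - 1) (1 - r) (∑ k ∈ Finset.range r, n k),
      A.SurvivesTo (r - 1) (A.barClass (by omega : 1 ≤ r) ha) y) ∧
    ∀ y : A.Page (r - 1) (1 - r) (∑ k ∈ Finset.range r, n k),
      A.SurvivesTo (r - 1) (A.barClass (by omega : 1 ≤ r) ha) y →
      ∃ m ∈ A.massey r n a,
        A.pageD (r - 1) (1 - r) (∑ k ∈ Finset.range r, n k) 0
            (∑ k ∈ Finset.range r, n k - r + 2) (by ring) (by ring) y =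
          A.toPage (r - 1) (∑ k ∈ Finset.range r, n k - r + 2) (by omega) m ∨
        A.pageD (r - 1) (1 - r) (∑ k ∈ Finset.range r, n k) 0
            (∑ k ∈ Finset.range r, n k - r + 2) (by ring) (by ring) y =
          -A.toPage (r - 1) (∑ k ∈ Finset.range r, n k - r + 2) (by omega) m := by
  obtain ⟨M, h⟩ := hdef
  have hr1 : 1 ≤ r := by omega
  have hcoc := h.masseySum_mem_cocycles hr1
  have hZ₁ : A.cutSum r n M ∈ A.Z 1 (1 - r) (∑ k ∈ Finset.range r, n k) :=
    h.cutSum_mem_Z hr1 (by omega)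
  have hZ : A.cutSum r n M ∈ A.Z (r - 1) (1 - r) (∑ k ∈ Finset.range r, n k) :=
    h.cutSum_mem_Z hr1 le_rfl
  have hx : A.pageMk 1 _ _ ⟨A.cutSum r n M, hZ₁⟩ = A.barClass hr1 ha := by
    refine (A.pageMk_eq_iff _ _).2 ?_
    have h2 := A.bar_sub_bar_mem_B_one hr1 ha h.diag_mem h.diag_class
    have := add_mem (h.cutSum_sub_bar_mem_B_one hr) h2
    rwa [sub_add_sub_cancel] at this
  have hsurv : A.SurvivesTo (r - 1) (A.barClass hr1 ha) (A.pageMk _ _ _ ⟨A.cutSum r n M, hZ⟩) :=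
    ⟨_, hZ₁, hZ, hx, rfl⟩
  refine ⟨⟨_, hsurv⟩, fun y hy => ?_⟩
  obtain rfl := CDGA.SurvivesTo.unique A (by omega) hy hsurv
  refine ⟨A.classH _ ⟨_, hcoc⟩, ⟨M, h, hcoc, rfl⟩, Or.inr ?_⟩
  have hD : A.D.restrict (fun _ hx => A.D_mem_Z (r := r - 1) (p := 1 - r)
      (q := ∑ k ∈ Finset.range r, n k) (p' := 0) (q' := ∑ k ∈ Finset.range r, n k - r + 2)
      (by ring) (by ring) hx) ⟨A.cutSum r n M, hZ⟩ =
      -⟨A.vertex _ ⟨_, hcoc.1⟩, A.vertex_mem_Z ⟨_, hcoc⟩⟩ :=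
    Subtype.ext (h.D_cutSum hr1)
  change A.pageMk _ _ _ (A.D.restrict _ ⟨A.cutSum r n M, hZ⟩) = -A.pageMk _ _ _ _
  rw [hD, map_neg]
  rfl
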